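/- Let $(Y,g)$ be a compact smooth Riemannian manifold without boundary, of dimension $m$, with Riemannian distance $d$ (infinite between different components) and Riemannian volume $\nu$. Let $V$ be a smooth vector field on $Y$ with flow $\varphi_t=e^{tV}$, and assume that it is Anosov: $V$ vanishes nowhere, and there are a continuous splitting $TY=\mathbb{R}V\oplus E^u\oplus E^s$, with $E^u,E^s$ invariant under the flow, and constants $C_0,c>0$ such that $\|d\varphi_t|_{E^s}\|\le C_0e^{-ct}$ and $\|d\varphi_{-t}|_{E^u}\|\le C_0e^{-ct}$ for all $t>0$. Let $$\Lambda_{\max}=\limsup_{t\to\infty}\,t^{-1}\sup_{y\in Y}\ln\|d\varphi_t(y)\|$$ be the maximal expansion rate and let $T_0$ be the shortest period, i.e. the infimum of all $t>0$ such that $\varphi_t(y)=y$ for some $y\in Y$. For $\varepsilon>0$ and $T>\tfrac12T_0$ define the lifted recurrence set $$\tilde S_{T,\varepsilon}=\{(y,t)\in Y\times\mathbb{R} : \tfrac12T_0\le t\le T,\ d(\varphi_t(y),y)\le\varepsilon\},$$ the recurrence set $S_{T,\varepsilon}=\pi_Y(\tilde S_{T,\varepsilon})\subset Y$ and the extended recurrence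 set $S^e_{T,\varepsilon}=\{y\in Y: d(y,S_{T,\varepsilon})\le\varepsilon\}$. Then for each $\lambda>\Lambda_{\max}$ there is a constant $C>0$, independent of $\varepsilon$ and $T$, such that for all $\varepsilon>0$ and all $T>\tfrac12T_0$ $$(\nu\otimes dt)\big(\tilde S_{T,\varepsilon}\big)\le C\,\varepsilon^{m}e^{m\lambda T},$$ and moreover $$\nu(S_{T,\varepsilon})\le C\,\varepsilon^{m-1}e^{m\lambda T},\qquad \nu(S^e_{T,\varepsilon})\le C\,\varepsilon^{m-1}e^{m\lambda T}.$$ -/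

import Mathlib

open Set Filter Topology MeasureTheory Manifold Bundle
open scoped ENNReal ContDiff

noncomputable section

namespace AnosovRecurrence

section Flow

variable {m : ℕ} {Y : Type*} [TopologicalSpace Y] [ChartedSpace (EuclideanSpace ℝ (Fin m)) Y]
  [IsManifold (𝓡 m) ∞ Y]

/-- A vector field (a section of the tangent bundle, not necessarily continuous) seen as a map
into the total space of the tangent bundle. -/
def toSection (X : ∀ y : Y, TangentSpace (𝓡 m) y) (y : Y) : TangentBundle (𝓡 m) Y := ⟨y, X y⟩

/-- `φ` is the (smooth) flow `e^{tV}` generated by the vector field `V`: the map `(t, y) ↦ φ t y`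
is smooth and its curves are the integral curves of `V`. The group law is part of `Flow`. -/
structure IsFlowOf (φ : Flow ℝ Y) (V : ∀ y : Y, TangentSpace (𝓡 m) y) : Prop where
  smooth : ContMDiff (𝓘(ℝ, ℝ).prod (𝓡 m)) (𝓡 m) ∞ (fun p : ℝ × Y => φ p.1 p.2)
  integralCurve : ∀ y : Y, IsMIntegralCurve (I := 𝓡 m) (fun t => φ t y) V

/-- A family of subspaces of the tangent spaces is a continuous subbundle: near each point it has
a frame of continuous vector fields. -/
def IsContinuousSubbundle (F : ∀ y : Y, Submodule ℝ (TangentSpace (𝓡 m) y)) : Prop :=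
  ∀ y₀ : Y, ∃ (k : ℕ) (X : Fin k → ∀ y : Y, TangentSpace (𝓡 m) y), ∃ U ∈ 𝓝 y₀,
    (∀ i, ContinuousOn (toSection (X i)) U) ∧
    ∀ y ∈ U, LinearIndependent ℝ (fun i => X i y) ∧
      Submodule.span ℝ (range fun i => X i y) = F y

/-- A family of subspaces of the tangent spaces is invariant under the flow. -/
def IsInvariantSubbundle (φ : Flow ℝ Y) (F : ∀ y : Y, Submodule ℝ (TangentSpace (𝓡 m) y)) :
    Prop :=
  ∀ (t : ℝ) (y : Y),
    (F y).map (mfderiv (𝓡 m) (𝓡 m) (φ t) y).toLinearMap = F (φ t y)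

/-- The shortest period `T₀` of a flow: the infimum of all `t > 0` with `φ t y = y` for some `y`
(it is `∞` if there is no periodic orbit). -/
def shortestPeriod (φ : Flow ℝ Y) : ℝ≥0∞ :=
  ⨅ t ∈ {t : ℝ | 0 < t ∧ ∃ y : Y, φ t y = y}, ENNReal.ofReal t

end Flow

section Riemannian

variable {m : ℕ} {Y : Type*} [TopologicalSpace Y] [ChartedSpace (EuclideanSpace ℝ (Fin m)) Y]
  [IsManifold (𝓡 m) ∞ Y] [RiemannianBundle (fun y : Y => TangentSpace (𝓡 m) y)]

/-- The flow `φ` of `V` is Anosov: `V` vanishes nowhere and there is a continuous, flow-invariant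
splitting `TY = ℝV ⊕ Eᵘ ⊕ Eˢ` for which `φ t` contracts `Eˢ` and `φ (-t)` contracts `Eᵘ`
exponentially, uniformly for `t > 0`. With the constant `C` allowed, the condition does not depend
on the Riemannian metric of a compact manifold, and it holds with `C = 1` for a suitable metric. -/
def IsAnosov (φ : Flow ℝ Y) (V : ∀ y : Y, TangentSpace (𝓡 m) y) : Prop :=
  (∀ y : Y, V y ≠ 0) ∧
  ∃ Eu Es : ∀ y : Y, Submodule ℝ (TangentSpace (𝓡 m) y),
    (∀ y : Y, DirectSum.IsInternal ![Submodule.span ℝ {V y}, Eu y, Es y]) ∧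
    IsContinuousSubbundle Eu ∧ IsContinuousSubbundle Es ∧
    IsInvariantSubbundle φ Eu ∧ IsInvariantSubbundle φ Es ∧
    ∃ C c : ℝ, 0 < C ∧ 0 < c ∧ ∀ t : ℝ, 0 < t → ∀ y : Y,
      (∀ v ∈ Es y, ‖mfderiv (𝓡 m) (𝓡 m) (φ t) y v‖ ≤ C * Real.exp (-c * t) * ‖v‖) ∧
      (∀ v ∈ Eu y, ‖mfderiv (𝓡 m) (𝓡 m) (φ (-t)) y v‖ ≤ C * Real.exp (-c * t) * ‖v‖)

variable (m) in
/-- The maximal expansion rate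
`Λ_max = limsup_{t → ∞} t⁻¹ sup_y log ‖dφ_t(y)‖` (operator norm for the Riemannian metric). -/
def maximalExpansionRate (φ : Flow ℝ Y) : EReal :=
  limsup (fun t : ℝ =>
    ⨆ y : Y, ((t⁻¹ * Real.log ‖mfderiv (𝓡 m) (𝓡 m) (φ t) y‖ : ℝ) : EReal)) atTop

end Riemannian

section Recurrence

variable {Y : Type*} [EMetricSpace Y]

/-- The lifted recurrence set in `Y × ℝ`: pairs `(y, t)` with `T₀ / 2 ≤ t ≤ T` and
`d(φ_t y, y) ≤ ε`. -/
def liftedRecurrenceSet (φ : Flow ℝ Y) (T ε : ℝ) : Set (Y × ℝ) :=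
  {p | 0 ≤ p.2 ∧ shortestPeriod φ / 2 ≤ ENNReal.ofReal p.2 ∧ p.2 ≤ T ∧
    edist (φ p.2 p.1) p.1 ≤ ENNReal.ofReal ε}

/-- The recurrence set `S_{T,ε}`, the projection of the lifted one to `Y`. -/
def recurrenceSet (φ : Flow ℝ Y) (T ε : ℝ) : Set Y :=
  {y | ∃ t : ℝ, (y, t) ∈ liftedRecurrenceSet φ T ε}

/-- The extended recurrence set `S^e_{T,ε}`: points at distance at most `ε` from `S_{T,ε}`. -/
def extendedRecurrenceSet (φ : Flow ℝ Y) (T ε : ℝ) : Set Y :=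
  {y | Metric.infEDist y (recurrenceSet φ T ε) ≤ ENNReal.ofReal ε}

variable [MeasurableSpace Y] [BorelSpace Y]

variable (Y) in
/-- The Riemannian volume of an `m`-dimensional Riemannian manifold whose extended distance is the
Riemannian one: the `m`-dimensional Hausdorff measure, normalized to be Lebesgue measure on
`ℝ^m`. -/
def riemannianVolume (m : ℕ) : Measure Y := Measure.euclideanHausdorffMeasure m

end Recurrence

end AnosovRecurrence

end

/-!
The mechanism is a rigidity of almost closed orbits. If `y` and `y'` stay within a fixed small
distance of each other for a time `t` and both return `ε`-close to themselves at time `t`, then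
`y'` is `O(ε)`-close to the orbit segment of `y` near `y`. Otherwise, rescaling the displacements
between such orbits at a time where they are nearly maximal modulo the flow and passing to a limit,
one would obtain a tangent vector, not parallel to `V`, whose image under `dφ_t` is bounded modulo
`V` for all `t ∈ ℝ`: near an end of the time interval the almost periodicity continues the orbits
past it. Hyperbolicity of the transverse dynamics excludes such vectors.

For `Λ_max < l < λ`, cover `Y` by about `e^{mlT}` balls of radius proportional to `e^{-lT}`. The
points of one ball which recur at nearly the same time lie in one flow tube of volume
`O(ε^{m-1})`, and factors polynomial in `T` are absorbed by `l < λ`.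
-/

open scoped NNReal

noncomputable section

namespace AnosovRecurrence

theorem exists_forall_of_isCompact_of_eventually {X ι : Type*} [TopologicalSpace X] [Preorder ι]
    [IsDirectedOrder ι] [Nonempty ι] {s : Set X} (hs : IsCompact s) {P : X → ι → Prop}
    (mono : ∀ x, Monotone (P x)) (h : ∀ x ∈ s, ∃ K, ∀ᶠ y in 𝓝 x, P y K) :
    ∃ K, ∀ x ∈ s, P x K := by
  refine hs.induction_on (p := fun u => ∃ K, ∀ x ∈ u, P x K) ⟨Classical.arbitrary ι, by simp⟩
    ?_ ?_ ?_
  · rintro u v huv ⟨K, hK⟩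
    exact ⟨K, fun x hx => hK x (huv hx)⟩
  · rintro u v ⟨K, hK⟩ ⟨K', hK'⟩
    obtain ⟨L, hL, hL'⟩ := exists_ge_ge K K'
    exact ⟨L, fun x hx => hx.elim (fun hx => mono x hL (hK x hx)) fun hx => mono x hL' (hK' x hx)⟩
  · intro x hx
    obtain ⟨K, hK⟩ := h x hx
    exact ⟨_, mem_nhdsWithin_of_mem_nhds hK, K, fun _ hy => hy⟩

section VectorBundle

variable {B B' : Type*} [TopologicalSpace B] [TopologicalSpace B']
  {F F' : Type*} [NormedAddCommGroup F] [NormedSpace ℝ F] [NormedAddCommGroup F']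
  [NormedSpace ℝ F']
  {E : B → Type*} [TopologicalSpace (TotalSpace F E)] [∀ x, NormedAddCommGroup (E x)]
  [∀ x, InnerProductSpace ℝ (E x)] [FiberBundle F E] [VectorBundle ℝ F E]
  [IsContinuousRiemannianBundle F E]
  {E' : B' → Type*} [TopologicalSpace (TotalSpace F' E')] [∀ x, NormedAddCommGroup (E' x)]
  [∀ x, InnerProductSpace ℝ (E' x)] [FiberBundle F' E'] [VectorBundle ℝ F' E']
  [IsContinuousRiemannianBundle F' E']

theorem eventually_norm_lt_of_continuousAt_inCoordinates {N : Type*} [TopologicalSpace N]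
    {f : N → B} {g : N → B'} {p : N} (A : ∀ q, E (f q) →L[ℝ] E' (g q)) (hf : ContinuousAt f p)
    (hg : ContinuousAt g p)
    (hA : ContinuousAt
      (fun q => ContinuousLinearMap.inCoordinates F E F' E' (f p) (f q) (g p) (g q) (A q)) p)
    {K : ℝ} (hK : ‖A p‖ < K) : ∀ᶠ q in 𝓝 p, ‖A q‖ < K := by
  let e := trivializationAt F E (f p)
  let e' := trivializationAt F' E' (g p)
  let D : N → E (f p) →L[ℝ] E' (g p) := fun q => e'.symmL ℝ (g p) ∘L
    ContinuousLinearMap.inCoordinates F E F' E' (f p) (f q) (g p) (g q) (A q) ∘L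
      e.continuousLinearMapAt ℝ (f p)
  have hD : ContinuousAt D p := continuousAt_const.clm_comp (hA.clm_comp continuousAt_const)
  have hbase : f p ∈ e.baseSet := FiberBundle.mem_baseSet_trivializationAt' _
  have hbase' : g p ∈ e'.baseSet := FiberBundle.mem_baseSet_trivializationAt' _
  have factor : ∀ q, f q ∈ e.baseSet → g q ∈ e'.baseSet →
      A q = (e'.symmL ℝ (g q) ∘L e'.continuousLinearMapAt ℝ (g p)) ∘L D q ∘L
        (e.symmL ℝ (f p) ∘L e.continuousLinearMapAt ℝ (f q)) := by
    intro q hq hq'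
    ext v
    simp only [D, ContinuousLinearMap.inCoordinates, ContinuousLinearMap.comp_apply]
    rw [e.continuousLinearMapAt_symmL hbase, e'.continuousLinearMapAt_symmL hbase',
      e'.symmL_continuousLinearMapAt hq', e.symmL_continuousLinearMapAt hq]
  have hDp : D p = A p := by
    ext v
    simp only [D, ContinuousLinearMap.inCoordinates, ContinuousLinearMap.comp_apply]
    rw [e.symmL_continuousLinearMapAt hbase, e'.symmL_continuousLinearMapAt hbase']
  obtain ⟨L, hL, hLK⟩ := exists_between hK
  have hL0 : 0 ≤ L := (norm_nonneg _).trans hL.le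
  obtain ⟨r, hrK, hr⟩ : ∃ r : ℝ, r * (L * r) < K ∧ 1 < r := by
    have : Tendsto (fun r : ℝ => r * (L * r)) (𝓝[>] 1) (𝓝 (1 * (L * 1))) :=
      (Continuous.tendsto (by fun_prop) 1).mono_left nhdsWithin_le_nhds
    exact ((this.eventually (gt_mem_nhds (by simpa using hLK))).and self_mem_nhdsWithin).exists
  filter_upwards [hf.eventually (eventually_norm_symmL_trivializationAt_self_comp_lt F E _ hr),
    hg.eventually (eventually_norm_symmL_trivializationAt_comp_self_lt F' E' _ hr),
    hf.eventually (e.open_baseSet.mem_nhds hbase),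
    hg.eventually (e'.open_baseSet.mem_nhds hbase'),
    hD.norm.eventually (gt_mem_nhds (hDp ▸ hL))] with q he he' hq hq' hDq
  calc ‖A q‖ ≤ r * (L * r) := by
        rw [factor q hq hq']
        refine (ContinuousLinearMap.opNorm_comp_le _ _).trans ?_
        gcongr
        refine (ContinuousLinearMap.opNorm_comp_le _ _).trans ?_
        gcongr
    _ < K := hrK

end VectorBundle

section Lipschitz

variable {E : Type*} [NormedAddCommGroup E] [NormedSpace ℝ E]
  {H : Type*} [TopologicalSpace H] {I : ModelWithCorners ℝ E H}
  {E' : Type*} [NormedAddCommGroup E'] [NormedSpace ℝ E']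
  {H' : Type*} [TopologicalSpace H'] {I' : ModelWithCorners ℝ E' H'}

theorem eventually_norm_mfderiv_partial_lt
    {G : Type*} [NormedAddCommGroup G] [NormedSpace ℝ G]
    {H₀ : Type*} [TopologicalSpace H₀] {J : ModelWithCorners ℝ G H₀}
    {N : Type*} [TopologicalSpace N] [ChartedSpace H₀ N] [IsManifold J 1 N]
    {M : Type*} [TopologicalSpace M] [ChartedSpace H M] [IsManifold I 1 M]
    [RiemannianBundle fun x : M => TangentSpace I x]
    [IsContinuousRiemannianBundle E fun x : M => TangentSpace I x]
    {M' : Type*} [TopologicalSpace M'] [ChartedSpace H' M'] [IsManifold I' 1 M']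
    [RiemannianBundle fun x : M' => TangentSpace I' x]
    [IsContinuousRiemannianBundle E' fun x : M' => TangentSpace I' x]
    {F : N → M → M'} {p : N × M} (hF : ContMDiffAt (J.prod I) I' 1 (Function.uncurry F) p)
    {K : ℝ} (hK : ‖mfderiv I I' (F p.1) p.2‖ < K) :
    ∀ᶠ q in 𝓝 p, ‖mfderiv I I' (F q.1) q.2‖ < K := by
  have hA : ContMDiffAt (J.prod I) 𝓘(ℝ, E →L[ℝ] E') 0 (inTangentCoordinates I I' Prod.snd
      (fun q : N × M => F q.1 q.2) (fun q => mfderiv I I' (F q.1) q.2) p) p :=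
    ContMDiffAt.mfderiv (n := 1) (fun q : N × M => F q.1) Prod.snd
      (hF.comp (p, p.2) (contMDiffAt_fst.fst.prodMk contMDiffAt_snd)) contMDiffAt_snd
      (by simp)
  exact eventually_norm_lt_of_continuousAt_inCoordinates
    (E := fun x : M => TangentSpace I x) (E' := fun x : M' => TangentSpace I' x)
    (fun q : N × M => mfderiv I I' (F q.1) q.2) continuousAt_snd hF.continuousAt
    hA.continuousAt hK

theorem pathELength_comp_le
    {M : Type*} [TopologicalSpace M] [ChartedSpace H M]
    [RiemannianBundle fun x : M => TangentSpace I x]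
    {M' : Type*} [TopologicalSpace M'] [ChartedSpace H' M']
    [RiemannianBundle fun x : M' => TangentSpace I' x]
    {f : M → M'} {γ : ℝ → M} {a b : ℝ} {K : ℝ≥0}
    (hf : ∀ t ∈ Icc a b, MDifferentiableAt I I' f (γ t))
    (hK : ∀ t ∈ Icc a b, ‖mfderiv I I' f (γ t)‖₊ ≤ K)
    (hγ : MDifferentiableOn 𝓘(ℝ) I γ (Icc a b)) :
    pathELength I' (f ∘ γ) a b ≤ K * pathELength I γ a b := by
  rcases lt_or_ge a b with hab | hab
  swap
  · simp [pathELength_eq_lintegral_mfderiv_Ioo, Ioo_eq_empty hab.not_gt]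
  rw [pathELength_eq_lintegral_mfderivWithin_Icc, pathELength_eq_lintegral_mfderivWithin_Icc,
    ← lintegral_const_mul' _ _ ENNReal.coe_ne_top]
  refine setLIntegral_mono' measurableSet_Icc fun t ht => ?_
  rw [mfderiv_comp_mfderivWithin t (hf t ht) (hγ t ht)
    (uniqueDiffOn_Icc hab t ht).uniqueMDiffWithinAt]
  exact ((mfderiv I I' f (γ t)).le_opENorm _).trans
    (mul_le_mul_left (ENNReal.coe_le_coe.2 (hK t ht)) _)

variable {M : Type*} [PseudoEMetricSpace M] [ChartedSpace H M]
  [RiemannianBundle fun x : M => TangentSpace I x] [IsRiemannianManifold I M]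
  {M' : Type*} [PseudoEMetricSpace M'] [ChartedSpace H' M']
  [RiemannianBundle fun x : M' => TangentSpace I' x] [IsRiemannianManifold I' M']

variable (I I')

theorem edist_map_le_of_nnnorm_mfderiv_le {f : M → M'} {K : ℝ≥0} {x y : M} {r : ℝ≥0∞}
    (hr : edist x y < r) (hf : ∀ z ∈ Metric.eball x r, ContMDiffAt I I' 1 f z)
    (hK : ∀ z ∈ Metric.eball x r, ‖mfderiv I I' f z‖₊ ≤ K) :
    edist (f x) (f y) ≤ K * edist x y := by
  have hpath : ∀ ρ, edist x y < ρ → ρ ≤ r → edist (f x) (f y) ≤ K * ρ := by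
    intro ρ hρ hρr
    rw [IsRiemannianManifold.out (I := I)] at hρ
    obtain ⟨γ, h0, h1, hγ, hl⟩ := exists_lt_of_riemannianEDist_lt hρ
    have hmem : ∀ t ∈ Icc (0 : ℝ) 1, γ t ∈ Metric.eball x r := by
      intro t ht
      rw [Metric.mem_eball, edist_comm, IsRiemannianManifold.out (I := I)]
      exact (riemannianEDist_le_pathELength (hγ.mono (Icc_subset_Icc_right ht.2)) h0 rfl
        ht.1).trans_lt ((pathELength_mono le_rfl ht.2).trans_lt (hl.trans_le hρr))
    rw [IsRiemannianManifold.out (I := I')]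
    have hfγ : ContMDiffOn 𝓘(ℝ) I' 1 (f ∘ γ) (Icc 0 1) := fun t ht =>
      (hf _ (hmem t ht)).comp_contMDiffWithinAt t (hγ t ht)
    calc riemannianEDist I' (f x) (f y) ≤ pathELength I' (f ∘ γ) 0 1 :=
          riemannianEDist_le_pathELength hfγ (by simp [h0]) (by simp [h1]) zero_le_one
      _ ≤ K * pathELength I γ 0 1 :=
          pathELength_comp_le (fun t ht => (hf _ (hmem t ht)).mdifferentiableAt one_ne_zero)
            (fun t ht => hK _ (hmem t ht)) (hγ.mdifferentiableOn one_ne_zero)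
      _ ≤ K * ρ := by gcongr
  rcases eq_or_ne K 0 with rfl | hK0
  · simpa using hpath r hr le_rfl
  rw [← ENNReal.div_le_iff' (by simpa using hK0) ENNReal.coe_ne_top]
  refine le_of_forall_gt_imp_ge_of_dense fun ρ hρ => ?_
  exact ENNReal.div_le_of_le_mul' ((hpath (min ρ r) (lt_min hρ hr) (min_le_right _ _)).trans
    (mul_le_mul_right (min_le_left _ _) _))

theorem lipschitzWith_of_nnnorm_mfderiv_le {f : M → M'} {K : ℝ≥0} (hK0 : K ≠ 0)
    (hf : ContMDiff I I' 1 f) (hK : ∀ x, ‖mfderiv I I' f x‖₊ ≤ K) : LipschitzWith K f := by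
  intro x y
  rcases eq_or_ne (edist x y) ⊤ with h | h
  · simp [h, ENNReal.mul_top, hK0]
  · exact edist_map_le_of_nnnorm_mfderiv_le I I' h.lt_top (fun z _ => hf z) fun z _ => hK z

omit [IsRiemannianManifold I M] [IsRiemannianManifold I' M'] in
theorem eventually_nnnorm_mfderiv_lt [IsManifold I 1 M] [IsManifold I' 1 M']
    [IsContinuousRiemannianBundle E fun x : M => TangentSpace I x]
    [IsContinuousRiemannianBundle E' fun x : M' => TangentSpace I' x]
    {f : M → M'} {x : M} (hf : ContMDiffAt I I' 1 f x) {K : ℝ≥0}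
    (hK : ‖mfderiv I I' f x‖₊ < K) : ∀ᶠ y in 𝓝 x, ‖mfderiv I I' f y‖₊ < K :=
  (continuous_id.prodMk continuous_id).continuousAt.eventually
    (eventually_norm_mfderiv_partial_lt (J := I) (F := fun _ : M => f) (p := (x, x))
      (hf.comp (x, x) contMDiffAt_snd) hK)

theorem exists_lipschitzOnWith_of_nnnorm_mfderiv_lt [IsManifold I 1 M] [IsManifold I' 1 M']
    [IsContinuousRiemannianBundle E fun x : M => TangentSpace I x]
    [IsContinuousRiemannianBundle E' fun x : M' => TangentSpace I' x]
    {f : M → M'} {x : M} (hf : ContMDiffAt I I' 1 f x) {K : ℝ≥0}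
    (hK : ‖mfderiv I I' f x‖₊ < K) : ∃ s ∈ 𝓝 x, LipschitzOnWith K f s := by
  obtain ⟨r, hr, hball⟩ := Metric.nhds_basis_eball.eventually_iff.1
    ((eventually_nnnorm_mfderiv_lt I I' hf hK).and
      ((contMDiffAt_iff_contMDiffAt_nhds (by simp)).1 hf))
  refine ⟨Metric.eball x (r / 2 / 2), Metric.eball_mem_nhds x
    (ENNReal.half_pos (ENNReal.half_pos hr.ne').ne'), fun y hy z hz => ?_⟩
  have hyz : edist y z < r / 2 :=
    ((edist_triangle_right y z x).trans_lt (ENNReal.add_lt_add hy hz)).trans_eq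
      (ENNReal.add_halves _)
  have hsub : ∀ w ∈ Metric.eball y (r / 2), w ∈ Metric.eball x r := fun w hw =>
    ((edist_triangle w y x).trans_lt (ENNReal.add_lt_add hw
      (hy.trans_le ENNReal.half_le_self))).trans_eq (ENNReal.add_halves _)
  exact edist_map_le_of_nnnorm_mfderiv_le I I' hyz (fun w hw => (hball (hsub w hw)).2)
    fun w hw => (hball (hsub w hw)).1.le

end Lipschitz

instance isContinuousRiemannianBundle_vectorSpace {F : Type*} [NormedAddCommGroup F]
    [InnerProductSpace ℝ F] :
    IsContinuousRiemannianBundle F (fun x : F => TangentSpace 𝓘(ℝ, F) x) :=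
  ⟨(riemannianMetricVectorSpace F).toContinuousRiemannianMetric.inner,
    (riemannianMetricVectorSpace F).contMDiff.continuous, fun _ _ _ => rfl⟩

section Displacement

variable {ι : Type*}
  {E : Type*} [NormedAddCommGroup E] [NormedSpace ℝ E]
  {H : Type*} [TopologicalSpace H] {I : ModelWithCorners ℝ E H}
  {E' : Type*} [NormedAddCommGroup E'] [NormedSpace ℝ E']
  {H' : Type*} [TopologicalSpace H'] {I' : ModelWithCorners ℝ E' H'}
  {M : Type*} [TopologicalSpace M] [ChartedSpace H M]
  {M' : Type*} [TopologicalSpace M'] [ChartedSpace H' M']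

variable (I) in
/-- The tangent vector `w` at `p` is the infinitesimal displacement from `a j` to `a' j` at the
scale `s j`: both families tend to `p` along the filter `l` and, in the preferred chart at `p`, the
difference `a' j - a j` divided by `s j` tends to `w`. It is the tool by which estimates at a small
scale are transferred to the tangent bundle. -/
structure IsDisplacement (l : Filter ι) (s : ι → ℝ) (a a' : ι → M) (p : M)
    (w : TangentSpace I p) : Prop where
  tendsto_left : Tendsto a l (𝓝 p)
  tendsto_right : Tendsto a' l (𝓝 p)
  tendsto_smul_sub : Tendsto (fun j => (s j)⁻¹ • (extChartAt I p (a' j) - extChartAt I p (a j))) l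
    (𝓝 (show E from w))

variable {l : Filter ι} {s : ι → ℝ} {a a' : ι → M} {p : M} {w : TangentSpace I p}

theorem tendsto_smul_sub_of_hasStrictFDerivAt {f : E → E'} {A : E →L[ℝ] E'} {x : E}
    (hf : HasStrictFDerivAt f A x) {c : ι → ℝ} {u u' : ι → E} (hu : Tendsto u l (𝓝 x))
    (hu' : Tendsto u' l (𝓝 x)) {v : E} (hv : Tendsto (fun j => c j • (u' j - u j)) l (𝓝 v)) :
    Tendsto (fun j => c j • (f (u' j) - f (u j))) l (𝓝 (A v)) := by
  have h1 : (fun j => f (u' j) - f (u j) - A (u' j - u j)) =o[l] fun j => u' j - u j :=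
    hf.isLittleO.comp_tendsto (hu'.prodMk_nhds hu)
  have h2 : Tendsto (fun j => c j • (f (u' j) - f (u j) - A (u' j - u j))) l (𝓝 0) :=
    (Asymptotics.isLittleO_one_iff ℝ).1
      (((Asymptotics.isBigO_refl c l).smul_isLittleO h1).trans_isBigO (hv.isBigO_one ℝ))
  simpa [Function.comp_def, ← smul_add] using h2.add ((A.continuous.tendsto v).comp hv)

theorem nnnorm_inv_smul_le {x : E} {r : ℝ} {C : ℝ≥0} (h : ‖x‖ₑ ≤ C * ‖r‖ₑ) :
    ‖r⁻¹ • x‖₊ ≤ C := by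
  rcases eq_or_ne r 0 with rfl | hr
  · simp
  · rw [nnnorm_smul, nnnorm_inv, inv_mul_le_iff₀ (by simpa using hr), mul_comm]
    rwa [enorm_eq_nnnorm, enorm_eq_nnnorm, ← ENNReal.coe_mul, ENNReal.coe_le_coe] at h

theorem isDisplacement_real {b b' : ι → ℝ} {τ v : ℝ} (hb : Tendsto b l (𝓝 τ))
    (hb' : Tendsto b' l (𝓝 τ)) (hv : Tendsto (fun j => (s j)⁻¹ * (b' j - b j)) l (𝓝 v)) :
    IsDisplacement 𝓘(ℝ) l s b b' τ v :=
  ⟨hb, hb', by simpa only [extChartAt_model_space_eq_id, smul_eq_mul] using! hv⟩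

theorem IsDisplacement.prodMk {b b' : ι → M'} {q : M'} {v : TangentSpace I' q}
    (h : IsDisplacement I l s a a' p w) (h' : IsDisplacement I' l s b b' q v) :
    IsDisplacement (I.prod I') l s (fun j => (a j, b j)) (fun j => (a' j, b' j)) (p, q) (w, v) where
  tendsto_left := h.tendsto_left.prodMk_nhds h'.tendsto_left
  tendsto_right := h.tendsto_right.prodMk_nhds h'.tendsto_right
  tendsto_smul_sub := by
    simpa [extChartAt_prod] using h.tendsto_smul_sub.prodMk_nhds h'.tendsto_smul_sub

theorem IsDisplacement.map [I.Boundaryless] (h : IsDisplacement I l s a a' p w) {f : M → M'}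
    (hf : ContMDiffAt I I' 1 f p) :
    IsDisplacement I' l s (f ∘ a) (f ∘ a') (f p) (mfderiv I I' f p w) where
  tendsto_left := hf.continuousAt.tendsto.comp h.tendsto_left
  tendsto_right := hf.continuousAt.tendsto.comp h.tendsto_right
  tendsto_smul_sub := by
    have hd : HasStrictFDerivAt (writtenInExtChartAt I I' p f) (mfderiv I I' f p)
        (extChartAt I p p) := by
      have hc := (contMDiffAt_iff.1 hf).2
      rw [I.range_eq_univ, contDiffWithinAt_univ] at hc
      rw [(hf.mdifferentiableAt one_ne_zero).mfderiv, I.range_eq_univ, fderivWithin_univ]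
      exact hc.hasStrictFDerivAt one_ne_zero
    have hχ := (continuousAt_extChartAt (I := I) p).tendsto
    refine (tendsto_smul_sub_of_hasStrictFDerivAt hd (hχ.comp h.tendsto_left)
      (hχ.comp h.tendsto_right) h.tendsto_smul_sub).congr' ?_
    filter_upwards [h.tendsto_left.eventually (extChartAt_source_mem_nhds (I := I) p),
      h.tendsto_right.eventually (extChartAt_source_mem_nhds (I := I) p)] with j hj hj'
    simp only [writtenInExtChartAt, Function.comp_apply, (extChartAt I p).left_inv hj,
      (extChartAt I p).left_inv hj']

end Displacement

section RiemannianDisplacement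

variable {ι : Type*} {E : Type*} [NormedAddCommGroup E] [InnerProductSpace ℝ E]
  {H : Type*} [TopologicalSpace H] {I : ModelWithCorners ℝ E H}
  {M : Type*} [PseudoEMetricSpace M] [ChartedSpace H M] [IsManifold I 1 M]
  [RiemannianBundle fun x : M => TangentSpace I x]
  [IsContinuousRiemannianBundle E fun x : M => TangentSpace I x] [IsRiemannianManifold I M]

variable (I) in
theorem exists_lipschitzOnWith_extChartAt (p : M) :
    ∃ K : ℝ≥0, ∃ u ∈ 𝓝 p, LipschitzOnWith K (extChartAt I p) u :=
  ⟨_, exists_lipschitzOnWith_of_nnnorm_mfderiv_lt I 𝓘(ℝ, E) contMDiffAt_extChartAt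
    (lt_add_one _)⟩

variable (I) in
theorem exists_lipschitzOnWith_extChartAt_symm [I.Boundaryless] (p : M) :
    ∃ K : ℝ≥0, ∃ u ∈ 𝓝 (extChartAt I p p), LipschitzOnWith K (extChartAt I p).symm u :=
  ⟨_, exists_lipschitzOnWith_of_nnnorm_mfderiv_lt 𝓘(ℝ, E) I
    ((contMDiffOn_extChartAt_symm p).contMDiffAt (extChartAt_target_mem_nhds p)) (lt_add_one _)⟩

variable {s : ι → ℝ} {a a' : ι → M} {p : M}

theorem exists_isDisplacement [FiniteDimensional ℝ E] {l : Ultrafilter ι}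
    (ha : Tendsto a l (𝓝 p)) (ha' : Tendsto a' l (𝓝 p)) {R : ℝ≥0}
    (h : ∀ᶠ j in (l : Filter ι), edist (a' j) (a j) ≤ R * ‖s j‖ₑ) :
    ∃ w : TangentSpace I p, IsDisplacement I l s a a' p w := by
  obtain ⟨K, u, hu, hK⟩ := exists_lipschitzOnWith_extChartAt I p
  let v : ι → E := fun j => (s j)⁻¹ • (extChartAt I p (a' j) - extChartAt I p (a j))
  have hv : ∀ᶠ j in (l : Filter ι), v j ∈ Metric.closedBall (0 : E) (K * R) := by
    filter_upwards [h, ha hu, ha' hu] with j hj hj₁ hj₂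
    rw [mem_closedBall_zero_iff, ← coe_nnnorm, ← NNReal.coe_mul, NNReal.coe_le_coe]
    refine nnnorm_inv_smul_le ?_
    rw [← edist_eq_enorm_sub, ENNReal.coe_mul, mul_assoc]
    exact (hK hj₂ hj₁).trans (by gcongr)
  obtain ⟨w, -, hw⟩ := (ProperSpace.isCompact_closedBall (0 : E) (K * R)).ultrafilter_le_nhds
    (l.map v) (by rwa [Ultrafilter.coe_map, le_principal_iff])
  exact ⟨w, ha, ha', hw⟩

variable {l : Filter ι} {w : TangentSpace I p}

omit [IsContinuousRiemannianBundle E fun x : M => TangentSpace I x]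
  [IsRiemannianManifold I M] in
theorem exists_contMDiffAt_mfderiv_eq_inner (w : TangentSpace I p) :
    ∃ f : M → ℝ, ContMDiffAt I 𝓘(ℝ) 1 f p ∧ ∀ v, mfderiv I 𝓘(ℝ) f p v = inner ℝ w v := by
  let L : E →L[ℝ] ℝ := (innerSL ℝ w : TangentSpace I p →L[ℝ] ℝ)
  refine ⟨L ∘ extChartAt I p, L.contMDiff.contMDiffAt.comp p contMDiffAt_extChartAt, fun v => ?_⟩
  rw [mfderiv_comp p L.mdifferentiableAt (mdifferentiableAt_extChartAt (mem_chart_source H p)),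
    mfderiv_extChartAt_self, L.mfderiv_eq]
  rfl

theorem IsDisplacement.nnnorm_le [I.Boundaryless] [l.NeBot] (hd : IsDisplacement I l s a a' p w)
    {R : ℝ≥0} (h : ∀ᶠ j in l, edist (a' j) (a j) ≤ R * ‖s j‖ₑ) : ‖w‖₊ ≤ R := by
  obtain ⟨f, hf, hdf⟩ := exists_contMDiffAt_mfderiv_eq_inner w
  have hnorm : ‖mfderiv I 𝓘(ℝ) f p‖₊ ≤ ‖w‖₊ := by
    refine ContinuousLinearMap.opNNNorm_le_bound _ _ fun v => ?_
    rw [nnnorm_tangentSpace_vectorSpace, hdf]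
    exact nnnorm_inner_le_nnnorm w v
  have hlim : Tendsto (fun j => (s j)⁻¹ • (f (a' j) - f (a j))) l (𝓝 (‖w‖ ^ 2)) := by
    have := (hd.map hf).tendsto_smul_sub
    rw [hdf, real_inner_self_eq_norm_sq] at this
    simpa only [extChartAt_model_space_eq_id] using! this
  have key : ∀ K : ℝ≥0, ‖w‖₊ < K → ‖w‖₊ ^ 2 ≤ K * R := by
    intro K hK
    obtain ⟨u, hu, hLip⟩ := exists_lipschitzOnWith_of_nnnorm_mfderiv_lt I 𝓘(ℝ) hf
      (hnorm.trans_lt hK)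
    have hev : ∀ᶠ j in l, ‖(s j)⁻¹ • (f (a' j) - f (a j))‖₊ ≤ K * R := by
      filter_upwards [h, hd.tendsto_left hu, hd.tendsto_right hu] with j hj hj₁ hj₂
      refine nnnorm_inv_smul_le ?_
      rw [← edist_eq_enorm_sub, ENNReal.coe_mul, mul_assoc]
      exact (hLip hj₂ hj₁).trans (by gcongr)
    simpa using le_of_tendsto hlim.nnnorm hev
  have hsq : ‖w‖₊ ^ 2 ≤ ‖w‖₊ * R := by
    have : Tendsto (fun K : ℝ≥0 => K * R) (𝓝[>] ‖w‖₊) (𝓝 (‖w‖₊ * R)) :=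
      (Continuous.tendsto (by fun_prop) _).mono_left nhdsWithin_le_nhds
    exact ge_of_tendsto this (eventually_nhdsWithin_of_forall key)
  rcases eq_zero_or_pos ‖w‖₊ with hw | hw
  · simp [hw]
  · rw [sq] at hsq
    exact le_of_mul_le_mul_left hsq hw

theorem IsDisplacement.eventually_edist_le_of_zero [I.Boundaryless]
    (hd : IsDisplacement I l s a a' p 0) (hs : ∀ᶠ j in l, s j ≠ 0) {η : ℝ≥0} (hη : 0 < η) :
    ∀ᶠ j in l, edist (a' j) (a j) ≤ η * ‖s j‖ₑ := by
  obtain ⟨K, u, hu, hK⟩ := exists_lipschitzOnWith_extChartAt_symm I p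
  have hχ := (continuousAt_extChartAt (I := I) p).tendsto
  have hsmall : ∀ᶠ j in l,
      K * ‖(s j)⁻¹ • (extChartAt I p (a' j) - extChartAt I p (a j))‖₊ < η := by
    have hlim := (hd.tendsto_smul_sub.nnnorm).const_mul K
    rw [show ‖(show E from (0 : TangentSpace I p))‖₊ = 0 from nnnorm_zero, mul_zero] at hlim
    exact hlim.eventually (gt_mem_nhds hη)
  filter_upwards [hs, hsmall, (hχ.comp hd.tendsto_left) hu, (hχ.comp hd.tendsto_right) hu,
    hd.tendsto_left.eventually (extChartAt_source_mem_nhds (I := I) p),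
    hd.tendsto_right.eventually (extChartAt_source_mem_nhds (I := I) p)]
    with j hsj hj hu hu' hj₁ hj₂
  have hle := hK hu' hu
  simp only [Function.comp_apply, (extChartAt I p).left_inv hj₁,
    (extChartAt I p).left_inv hj₂] at hle
  rw [nnnorm_smul, nnnorm_inv, ← div_eq_inv_mul, mul_div_assoc',
    div_lt_iff₀ (by simpa using hsj), ← ENNReal.coe_lt_coe, ENNReal.coe_mul, ENNReal.coe_mul] at hj
  rw [edist_eq_enorm_sub] at hle
  exact hle.trans hj.le

end RiemannianDisplacement

section Flow

variable {m : ℕ} {Y : Type*} [TopologicalSpace Y] [ChartedSpace (EuclideanSpace ℝ (Fin m)) Y]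
  {φ : Flow ℝ Y} {V : ∀ y : Y, TangentSpace (𝓡 m) y}

theorem IsFlowOf.contMDiff_time (hφ : IsFlowOf φ V) (t : ℝ) : ContMDiff (𝓡 m) (𝓡 m) ∞ (φ t) :=
  hφ.smooth.comp (contMDiff_const.prodMk contMDiff_id)

theorem IsFlowOf.mdifferentiableAt_time (hφ : IsFlowOf φ V) (t : ℝ) (y : Y) :
    MDifferentiableAt (𝓡 m) (𝓡 m) (φ t) y :=
  (hφ.contMDiff_time t).mdifferentiableAt (by simp)

theorem IsFlowOf.contMDiff_orbit (hφ : IsFlowOf φ V) (y : Y) :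
    ContMDiff 𝓘(ℝ) (𝓡 m) ∞ fun t => φ t y :=
  hφ.smooth.comp (contMDiff_id.prodMk contMDiff_const)

theorem IsFlowOf.mfderiv_orbit_apply (hφ : IsFlowOf φ V) (y : Y) (t b : ℝ) :
    mfderiv 𝓘(ℝ) (𝓡 m) (fun s => φ s y) t b = b • V (φ t y) := by
  rw [(hφ.integralCurve y t).mfderiv]
  rfl

theorem IsFlowOf.mfderiv_uncurry_apply (hφ : IsFlowOf φ V) (t : ℝ) (y : Y) (b : ℝ)
    (w : TangentSpace (𝓡 m) y) :
    mfderiv (𝓘(ℝ).prod (𝓡 m)) (𝓡 m) (fun q : ℝ × Y => φ q.1 q.2) (t, y) (b, w) =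
      mfderiv (𝓡 m) (𝓡 m) (φ t) y w + b • V (φ t y) := by
  rw [add_comm, ← hφ.mfderiv_orbit_apply]
  exact mfderiv_prod_eq_add_apply (I := 𝓘(ℝ)) (I' := 𝓡 m) (p := (t, y)) (v := (b, w))
    (hφ.smooth.mdifferentiableAt (by simp))

theorem IsFlowOf.tangentMap_add (hφ : IsFlowOf φ V) (s t : ℝ) (p : TangentBundle (𝓡 m) Y) :
    tangentMap (𝓡 m) (𝓡 m) (φ (s + t)) p =
      tangentMap (𝓡 m) (𝓡 m) (φ s) (tangentMap (𝓡 m) (𝓡 m) (φ t) p) := by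
  have : (φ (s + t) : Y → Y) = φ s ∘ φ t := funext (φ.map_add s t)
  rw [this, tangentMap_comp_at p (hφ.mdifferentiableAt_time s _) (hφ.mdifferentiableAt_time t _)]

theorem tangentMap_flow_zero (φ : Flow ℝ Y) (p : TangentBundle (𝓡 m) Y) :
    tangentMap (𝓡 m) (𝓡 m) (φ 0) p = p := by
  have : (φ 0 : Y → Y) = id := funext φ.map_zero_apply
  rw [this, tangentMap_id, id]

theorem IsFlowOf.tangentMap_orbit (hφ : IsFlowOf φ V) (y : Y) (t : ℝ) :
    tangentMap 𝓘(ℝ) (𝓡 m) (fun s => φ s y) ⟨t, (1 : ℝ)⟩ = toSection V (φ t y) :=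
  congrArg (TotalSpace.mk (φ t y)) ((hφ.mfderiv_orbit_apply y t 1).trans (one_smul ℝ _))

theorem IsFlowOf.tangentMap_toSection (hφ : IsFlowOf φ V) (t : ℝ) (y : Y) :
    tangentMap (𝓡 m) (𝓡 m) (φ t) (toSection V y) = toSection V (φ t y) := by
  have hcomm : φ t ∘ (fun s => φ s y) = fun s => φ s (φ t y) :=
    funext fun s => by simp only [Function.comp_apply, ← φ.map_add, add_comm]
  have hcomp := tangentMap_comp_at (I := 𝓘(ℝ)) (I' := 𝓡 m) (I'' := 𝓡 m) ⟨0, (1 : ℝ)⟩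
    (hφ.mdifferentiableAt_time t (φ 0 y)) ((hφ.contMDiff_orbit y).mdifferentiableAt (by simp))
  rw [hcomm, hφ.tangentMap_orbit, hφ.tangentMap_orbit] at hcomp
  simpa only [φ.map_zero_apply] using hcomp.symm

theorem IsFlowOf.mfderiv_vectorField (hφ : IsFlowOf φ V) (t : ℝ) (y : Y) :
    mfderiv (𝓡 m) (𝓡 m) (φ t) y (V y) = V (φ t y) :=
  eq_of_heq (TotalSpace.mk.inj (hφ.tangentMap_toSection t y)).2

theorem IsFlowOf.isDisplacement_flow (hφ : IsFlowOf φ V) {ι : Type*} {l : Filter ι}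
    {s β : ι → ℝ} {a a' : ι → Y} {p : Y} {w : TangentSpace (𝓡 m) p} {b : ℝ}
    (hd : IsDisplacement (𝓡 m) l s a a' p w) (hβ : Tendsto β l (𝓝 0))
    (hb : Tendsto (fun j => (s j)⁻¹ * β j) l (𝓝 b)) (τ : ℝ) :
    IsDisplacement (𝓡 m) l s (fun j => φ τ (a j)) (fun j => φ (τ + β j) (a' j)) (φ τ p)
      (mfderiv (𝓡 m) (𝓡 m) (φ τ) p w + b • V (φ τ p)) := by
  have hτ : IsDisplacement 𝓘(ℝ) l s (fun _ => τ) (fun j => τ + β j) τ b :=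
    isDisplacement_real tendsto_const_nhds (by simpa using hβ.const_add τ) (by simpa using hb)
  have := (hτ.prodMk hd).map ((hφ.smooth (τ, p)).of_le (by simp))
  rwa [hφ.mfderiv_uncurry_apply] at this

theorem IsFlowOf.continuous_toSection [IsManifold (𝓡 m) ∞ Y] (hφ : IsFlowOf φ V) :
    Continuous (toSection V) := by
  have hzero : Continuous fun y : Y => (zeroSection (EuclideanSpace ℝ (Fin m))
      (TangentSpace (𝓡 m) : Y → Type _) y : TangentBundle (𝓡 m) Y) :=
    (contMDiff_zeroSection ℝ (TangentSpace (𝓡 m) : Y → Type _) (n := 0) (IB := 𝓡 m)).continuous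
  have hsymm := (contMDiff_equivTangentBundleProd_symm (I := 𝓘(ℝ)) (M := ℝ) (I' := 𝓡 m)
    (M' := Y) (n := 0)).continuous
  refine ((hφ.smooth.continuous_tangentMap (by simp)).comp
    (hsymm.comp ((continuous_const (y := (⟨0, (1 : ℝ)⟩ : TangentBundle 𝓘(ℝ) ℝ))).prodMk
      hzero))).congr fun y => ?_
  have h := hφ.mfderiv_uncurry_apply 0 y 1 0
  rw [map_zero, zero_add, one_smul] at h
  exact (congrArg (TotalSpace.mk (φ 0 y)) h).trans
    (congrArg (toSection V) (φ.map_zero_apply y))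

end Flow

section RiemannianFlow

variable {m : ℕ} {Y : Type*} [TopologicalSpace Y] [ChartedSpace (EuclideanSpace ℝ (Fin m)) Y]
  [RiemannianBundle fun y : Y => TangentSpace (𝓡 m) y]
  {φ : Flow ℝ Y} {V : ∀ y : Y, TangentSpace (𝓡 m) y}

theorem IsFlowOf.nnnorm_mfderiv_orbit (hφ : IsFlowOf φ V) (y : Y) (t : ℝ) :
    ‖mfderiv 𝓘(ℝ) (𝓡 m) (fun s => φ s y) t‖₊ = ‖V (φ t y)‖₊ := by
  refine le_antisymm (ContinuousLinearMap.opNNNorm_le_bound _ _ fun b => ?_) ?_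
  · rw [nnnorm_tangentSpace_vectorSpace]
    exact (congrArg nnnorm (hφ.mfderiv_orbit_apply y t b)).trans_le
      ((nnnorm_smul (show ℝ from b) (V (φ t y))).trans (mul_comm _ _)).le
  · have h := (mfderiv 𝓘(ℝ) (𝓡 m) (fun s => φ s y) t).le_opNNNorm (1 : ℝ)
    rw [hφ.mfderiv_orbit_apply y t 1, one_smul] at h
    have hone : ‖(show TangentSpace 𝓘(ℝ) t from (1 : ℝ))‖₊ = 1 :=
      nnnorm_tangentSpace_vectorSpace.trans nnnorm_one
    exact h.trans_eq ((congrArg _ hone).trans (mul_one _))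

variable [IsManifold (𝓡 m) ∞ Y]
  [IsContinuousRiemannianBundle (EuclideanSpace ℝ (Fin m)) fun y : Y => TangentSpace (𝓡 m) y]

theorem IsFlowOf.exists_nnnorm_mfderiv_le [CompactSpace Y] (hφ : IsFlowOf φ V) (N : ℝ) :
    ∃ K : ℝ≥0, ∀ t, |t| ≤ N → ∀ y, ‖mfderiv (𝓡 m) (𝓡 m) (φ t) y‖₊ ≤ K := by
  obtain ⟨K, hK⟩ := exists_forall_of_isCompact_of_eventually
    ((isCompact_Icc (a := -N) (b := N)).prod (isCompact_univ (X := Y)))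
    (P := fun q (K : ℝ≥0) => ‖mfderiv (𝓡 m) (𝓡 m) (φ q.1) q.2‖₊ ≤ K)
    (fun _ _ _ hab h => h.trans hab)
    fun q _ => ⟨‖mfderiv (𝓡 m) (𝓡 m) (φ q.1) q.2‖₊ + 1,
      (eventually_norm_mfderiv_partial_lt (F := fun t => φ t)
        ((hφ.smooth q).of_le (by simp)) (lt_add_one _)).mono fun _ h => h.le⟩
  exact ⟨K, fun t ht y => hK (t, y) ⟨abs_le.1 ht, mem_univ y⟩⟩

theorem IsFlowOf.continuous_norm_vectorField (hφ : IsFlowOf φ V) : Continuous fun y => ‖V y‖ := by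
  simp only [norm_eq_sqrt_real_inner]
  exact (Continuous.inner_bundle (F := EuclideanSpace ℝ (Fin m))
    (E := fun y : Y => TangentSpace (𝓡 m) y) (b := id)
    hφ.continuous_toSection hφ.continuous_toSection).sqrt

theorem IsFlowOf.exists_nnnorm_vectorField_le [CompactSpace Y] (hφ : IsFlowOf φ V) :
    ∃ K : ℝ≥0, ∀ y, ‖V y‖₊ ≤ K := by
  obtain ⟨K, hK⟩ := isCompact_univ.bddAbove_image hφ.continuous_norm_vectorField.continuousOn
  exact ⟨K.toNNReal, fun y => NNReal.le_toNNReal_of_coe_le (hK ⟨y, mem_univ y, rfl⟩)⟩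

theorem IsFlowOf.exists_pos_forall_le_norm_vectorField [CompactSpace Y] (hφ : IsFlowOf φ V)
    (hV : ∀ y, V y ≠ 0) : ∃ κ > 0, ∀ y, κ ≤ ‖V y‖ := by
  obtain ⟨κ, hκ, h⟩ := isCompact_univ.exists_forall_le' hφ.continuous_norm_vectorField.continuousOn
    (a := 0) fun y _ => norm_pos_iff.2 (hV y)
  exact ⟨κ, hκ, fun y => h y (mem_univ y)⟩

end RiemannianFlow

section RiemannianFlowDistance

variable {m : ℕ} {Y : Type*} [PseudoEMetricSpace Y] [ChartedSpace (EuclideanSpace ℝ (Fin m)) Y]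
  [RiemannianBundle fun y : Y => TangentSpace (𝓡 m) y] [IsManifold (𝓡 m) ∞ Y]
  [IsContinuousRiemannianBundle (EuclideanSpace ℝ (Fin m)) fun y : Y => TangentSpace (𝓡 m) y]
  [IsRiemannianManifold (𝓡 m) Y] {φ : Flow ℝ Y} {V : ∀ y : Y, TangentSpace (𝓡 m) y}

theorem IsFlowOf.exists_lipschitzWith [CompactSpace Y] (hφ : IsFlowOf φ V) (N : ℝ) :
    ∃ K : ℝ≥0, ∀ t, |t| ≤ N → LipschitzWith K (φ t) := by
  obtain ⟨K, hK⟩ := hφ.exists_nnnorm_mfderiv_le N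
  exact ⟨K + 1, fun t ht => lipschitzWith_of_nnnorm_mfderiv_le (𝓡 m) (𝓡 m) (by simp)
    ((hφ.contMDiff_time t).of_le (by simp)) fun y => (hK t ht y).trans (by simp)⟩

theorem IsFlowOf.exists_edist_le_mul_enorm [CompactSpace Y] (hφ : IsFlowOf φ V) :
    ∃ K : ℝ≥0, ∀ x β, edist (φ β x) x ≤ K * ‖β‖ₑ := by
  obtain ⟨K, hK⟩ := hφ.exists_nnnorm_vectorField_le
  refine ⟨K + 1, fun x β => ?_⟩
  have hLip := lipschitzWith_of_nnnorm_mfderiv_le 𝓘(ℝ) (𝓡 m) (K := K + 1) (by simp)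
    ((hφ.contMDiff_orbit x).of_le (by simp)) fun t =>
      (hφ.nnnorm_mfderiv_orbit x t).trans_le ((hK _).trans (by simp))
  simpa [edist_zero_right] using hLip β 0

theorem IsFlowOf.exists_enorm_le_mul_edist [CompactSpace Y] (hφ : IsFlowOf φ V)
    (hV : ∀ y, V y ≠ 0) :
    ∃ K : ℝ≥0, ∃ δ > 0, ∀ x β, |β| ≤ δ → ‖β‖ₑ ≤ K * edist (φ β x) x := by
  by_contra! hcon
  choose x β hβ hlt using fun n : ℕ => hcon n (1 / ((n : ℝ) + 1)) Nat.one_div_pos_of_nat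
  let l := hyperfilter ℕ
  obtain ⟨p, -, hp⟩ := isCompact_univ.ultrafilter_le_nhds (l.map x) (by simp)
  have hl : (l : Filter ℕ) ≤ atTop := Nat.hyperfilter_le_atTop
  have hβ0 : Tendsto β l (𝓝 0) :=
    squeeze_zero_norm hβ (tendsto_one_div_add_atTop_nhds_zero_nat.mono_left hl)
  have hβne : ∀ n, β n ≠ 0 := fun n h => by simpa [h] using hlt n
  have hx : IsDisplacement (𝓡 m) l β x x p 0 := ⟨hp, hp, by simpa using! tendsto_const_nhds⟩
  have hd := hφ.isDisplacement_flow hx hβ0 (b := 1) (by simp [hβne]) 0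
  simp only [φ.map_zero_apply, map_zero, zero_add, one_smul] at hd
  refine hV p (nnnorm_eq_zero.1 (le_antisymm (le_of_forall_pos_le_add fun R hR => ?_) zero_le))
  rw [zero_add]
  suffices h : ‖V (φ 0 p)‖₊ ≤ R by rwa [φ.map_zero_apply] at h
  refine hd.nnnorm_le ?_
  filter_upwards [hl (eventually_ge_atTop ⌈R⁻¹⌉₊)] with n hn
  have hRn : 1 ≤ R * n := by
    rw [← inv_le_iff_one_le_mul₀' hR]
    exact Nat.ceil_le.1 hn
  calc edist (φ (β n) (x n)) (x n) ≤ (R * n : ℝ≥0) * edist (φ (β n) (x n)) (x n) :=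
        le_mul_of_one_le_left' (by exact_mod_cast hRn)
    _ ≤ R * ‖β n‖ₑ := by
        rw [ENNReal.coe_mul, mul_assoc]
        exact mul_le_mul_right (hlt n).le _

end RiemannianFlowDistance

theorem exists_smul_add_add_eq_of_isInternal {R E : Type*} [Ring R] [AddCommGroup E] [Module R E]
    {x : E} {F G : Submodule R E} (h : DirectSum.IsInternal ![Submodule.span R {x}, F, G])
    (w : E) : ∃ α : R, ∃ u ∈ F, ∃ v ∈ G, α • x + (u + v) = w := by
  have htop : Submodule.span R {x} ⊔ (F ⊔ G) = ⊤ := by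
    simpa [iSup_fin_three, sup_assoc] using h.submodule_iSup_eq_top
  obtain ⟨_, hα, _, huv, hw⟩ := Submodule.mem_sup.1 (htop ▸ Submodule.mem_top : w ∈ _)
  obtain ⟨α, rfl⟩ := Submodule.mem_span_singleton.1 hα
  obtain ⟨u, hu, v, hv, rfl⟩ := Submodule.mem_sup.1 huv
  exact ⟨α, u, hu, v, hv, hw⟩

section QuasiAnosov

variable {m : ℕ} {Y : Type*} [TopologicalSpace Y] [ChartedSpace (EuclideanSpace ℝ (Fin m)) Y]
  [RiemannianBundle fun y : Y => TangentSpace (𝓡 m) y]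
  {φ : Flow ℝ Y} {V : ∀ y : Y, TangentSpace (𝓡 m) y}

/-- The flow `φ` of `V` is quasi-Anosov: `V` vanishes nowhere, and a tangent vector whose images
under all the differentials `dφ_t` stay bounded, modulo the direction of `V`, is a multiple of
`V`. -/
def IsQuasiAnosov (φ : Flow ℝ Y) (V : ∀ y : Y, TangentSpace (𝓡 m) y) : Prop :=
  (∀ y : Y, V y ≠ 0) ∧
  ∀ (y : Y) (v : TangentSpace (𝓡 m) y),
    (∃ B : ℝ, ∀ t, ∃ b : ℝ, ‖mfderiv (𝓡 m) (𝓡 m) (φ t) y v + b • V (φ t y)‖ ≤ B) →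
      v ∈ Submodule.span ℝ {V y}

theorem IsFlowOf.norm_mfderiv_neg_mfderiv (hφ : IsFlowOf φ V) (t : ℝ) (y : Y)
    (v : TangentSpace (𝓡 m) y) :
    ‖mfderiv (𝓡 m) (𝓡 m) (φ (-t)) (φ t y) (mfderiv (𝓡 m) (𝓡 m) (φ t) y v)‖ = ‖v‖ := by
  have h := hφ.tangentMap_add (-t) t ⟨y, v⟩
  rw [neg_add_cancel, tangentMap_flow_zero] at h
  exact congrArg (fun p : TangentBundle (𝓡 m) Y => ‖p.2‖) h.symm

/-- If `dφ_r` contracts `v` strongly, then it must move `v + b V` by about `b V`, so that `b` is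
controlled by `v + b V`. -/
theorem IsFlowOf.norm_le_mul_norm_add_smul (hφ : IsFlowOf φ V) {κ N L θ r : ℝ} (hκ : 0 < κ)
    (hκV : ∀ y, κ ≤ ‖V y‖) (hNV : ∀ y, ‖V y‖ ≤ N) {y : Y}
    (hL : ‖mfderiv (𝓡 m) (𝓡 m) (φ r) y‖ ≤ L) (hθ : N * θ ≤ κ / 2) {v : TangentSpace (𝓡 m) y}
    (hv : ‖mfderiv (𝓡 m) (𝓡 m) (φ r) y v‖ ≤ θ * ‖v‖) (b : ℝ) :
    ‖v‖ ≤ 2 * (1 + N * L / κ) * ‖v + b • V y‖ := by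
  have hN : 0 ≤ N := (norm_nonneg _).trans (hNV y)
  have himage : b • V (φ r y) =
      mfderiv (𝓡 m) (𝓡 m) (φ r) y (v + b • V y) - mfderiv (𝓡 m) (𝓡 m) (φ r) y v := by
    rw [map_add, map_smul, hφ.mfderiv_vectorField, add_sub_cancel_left]
  have hb : |b| * κ ≤ L * ‖v + b • V y‖ + θ * ‖v‖ :=
    calc |b| * κ ≤ ‖b • V (φ r y)‖ := by
          rw [norm_smul, Real.norm_eq_abs]
          gcongr
          exact hκV _
      _ ≤ _ := by
          rw [himage]
          exact (norm_sub_le _ _).trans (add_le_add (ContinuousLinearMap.le_of_opNorm_le _ hL _) hv)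
  have hvb : ‖v‖ ≤ ‖v + b • V y‖ + |b| * N :=
    calc ‖v‖ = ‖v + b • V y - b • V y‖ := by rw [add_sub_cancel_right]
      _ ≤ ‖v + b • V y‖ + ‖b • V y‖ := norm_sub_le _ _
      _ ≤ _ := by
          rw [norm_smul, Real.norm_eq_abs]
          gcongr
          exact hNV y
  have hbN : |b| * N ≤ N * L / κ * ‖v + b • V y‖ + ‖v‖ / 2 :=
    calc |b| * N = N * (|b| * κ) / κ := by field_simp
      _ ≤ N * (L * ‖v + b • V y‖ + θ * ‖v‖) / κ := by gcongr
      _ = N * L / κ * ‖v + b • V y‖ + N * θ * ‖v‖ / κ := by ring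
      _ ≤ N * L / κ * ‖v + b • V y‖ + κ / 2 * ‖v‖ / κ := by gcongr
      _ = _ := by field_simp
  linarith

variable [IsManifold (𝓡 m) ∞ Y] [CompactSpace Y]
  [IsContinuousRiemannianBundle (EuclideanSpace ℝ (Fin m)) fun y : Y => TangentSpace (𝓡 m) y]

theorem IsFlowOf.exists_norm_le_mul_norm_add_smul (hφ : IsFlowOf φ V) (hV : ∀ y, V y ≠ 0)
    {F : ∀ y : Y, Submodule ℝ (TangentSpace (𝓡 m) y)} {C c σ : ℝ} (hc : 0 < c)
    (hF : ∀ t > 0, ∀ y, ∀ v ∈ F y,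
      ‖mfderiv (𝓡 m) (𝓡 m) (φ (σ * t)) y v‖ ≤ C * Real.exp (-c * t) * ‖v‖) :
    ∃ A : ℝ, 0 ≤ A ∧ ∀ y, ∀ v ∈ F y, ∀ b : ℝ, ‖v‖ ≤ A * ‖v + b • V y‖ := by
  obtain ⟨κ, hκ, hκV⟩ := hφ.exists_pos_forall_le_norm_vectorField hV
  obtain ⟨N, hNV⟩ := hφ.exists_nnnorm_vectorField_le
  obtain ⟨t, ht, hθ⟩ : ∃ t > 0, N * (C * Real.exp (-c * t)) ≤ κ / 2 := by
    have hlim : Tendsto (fun t : ℝ => N * (C * Real.exp (-c * t))) atTop (𝓝 0) := by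
      simpa using ((Real.tendsto_exp_atBot.comp
        (tendsto_id.const_mul_atTop_of_neg (neg_neg_of_pos hc))).const_mul C).const_mul (N : ℝ)
    exact ((eventually_gt_atTop 0).and (hlim.eventually_le_const (half_pos hκ))).exists
  obtain ⟨L, hL⟩ := hφ.exists_nnnorm_mfderiv_le |σ * t|
  exact ⟨2 * (1 + N * L / κ), by positivity, fun y v hv b =>
    hφ.norm_le_mul_norm_add_smul hκ hκV hNV (hL _ le_rfl y) hθ (hF t ht y v hv) b⟩

theorem IsFlowOf.eq_zero_of_contracted (hφ : IsFlowOf φ V) (hV : ∀ y, V y ≠ 0)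
    {F : ∀ y : Y, Submodule ℝ (TangentSpace (𝓡 m) y)} (hinv : IsInvariantSubbundle φ F)
    {C c σ : ℝ} (hC : 0 ≤ C) (hc : 0 < c)
    (hF : ∀ t > 0, ∀ y, ∀ v ∈ F y,
      ‖mfderiv (𝓡 m) (𝓡 m) (φ (σ * t)) y v‖ ≤ C * Real.exp (-c * t) * ‖v‖)
    {y : Y} {v : TangentSpace (𝓡 m) y} (hv : v ∈ F y) {B : ℝ}
    (hB : ∀ t > 0, ∃ b : ℝ, ‖mfderiv (𝓡 m) (𝓡 m) (φ (-(σ * t))) y v + b • V (φ (-(σ * t)) y)‖ ≤ B) :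
    v = 0 := by
  obtain ⟨A, hA, hangle⟩ := hφ.exists_norm_le_mul_norm_add_smul hV hc hF
  have hbound : ∀ t > 0, ‖v‖ ≤ C * Real.exp (-c * t) * (A * B) := fun t ht => by
    obtain ⟨b, hb⟩ := hB t ht
    have hmem := hinv (-(σ * t)) y ▸ Submodule.mem_map_of_mem hv
    have hcontr := hF t ht _ _ hmem
    have hback := hφ.norm_mfderiv_neg_mfderiv (-(σ * t)) y v
    rw [neg_neg] at hback
    refine hback.symm.trans_le (hcontr.trans ?_)
    gcongr
    exact (hangle _ _ hmem b).trans (mul_le_mul_of_nonneg_left hb hA)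
  have hlim : Tendsto (fun t : ℝ => C * Real.exp (-c * t) * (A * B)) atTop (𝓝 0) := by
    simpa using ((Real.tendsto_exp_atBot.comp
      (tendsto_id.const_mul_atTop_of_neg (neg_neg_of_pos hc))).const_mul C).mul_const (A * B)
  exact norm_le_zero_iff.1 (ge_of_tendsto hlim ((eventually_gt_atTop 0).mono hbound))

theorem IsAnosov.isQuasiAnosov (hA : IsAnosov φ V) (hφ : IsFlowOf φ V) : IsQuasiAnosov φ V := by
  obtain ⟨hV, Eu, Es, hint, -, -, hu, hs, C, c, hC, hc, h⟩ := hA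
  refine ⟨hV, fun y w ⟨B, hB⟩ => ?_⟩
  obtain ⟨α, u, huE, s, hsE, rfl⟩ := exists_smul_add_add_eq_of_isInternal (hint y) w
  have hexp : ∀ t > 0, ∀ r ≥ 0, C * Real.exp (-c * t) * r ≤ C * r := fun t ht r hr => by
    have : Real.exp (-c * t) ≤ 1 := Real.exp_le_one_iff.2 (by nlinarith)
    gcongr
    exact mul_le_of_le_one_right hC.le this
  have hrest : ∀ t (x z : TangentSpace (𝓡 m) y), x + z = u + s →
      ‖mfderiv (𝓡 m) (𝓡 m) (φ t) y z‖ ≤ C * ‖z‖ →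
      ∃ b : ℝ, ‖mfderiv (𝓡 m) (𝓡 m) (φ t) y x + b • V (φ t y)‖ ≤ B + C * ‖z‖ := by
    intro t x z hxz hz
    obtain ⟨b, hb⟩ := hB t
    refine ⟨α + b, ?_⟩
    rw [← hxz, map_add, map_smul, map_add, hφ.mfderiv_vectorField] at hb
    refine le_trans (le_of_eq ?_) ((norm_sub_le _ _).trans (add_le_add hb hz))
    congr 1
    module
  have hu0 : u = 0 := by
    refine hφ.eq_zero_of_contracted hV hu (σ := -1) hC.le hc (fun t ht y => ?_) huE
      (B := B + C * ‖s‖) fun t ht => ?_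
    · rw [neg_one_mul]
      exact (h t ht y).2
    · rw [neg_one_mul, neg_neg]
      exact hrest t u s rfl (((h t ht y).1 s hsE).trans (hexp t ht _ (norm_nonneg _)))
  have hs0 : s = 0 := by
    refine hφ.eq_zero_of_contracted hV hs (σ := 1) hC.le hc (fun t ht y => ?_) hsE
      (B := B + C * ‖u‖) fun t ht => ?_
    · rw [one_mul]
      exact (h t ht y).1
    · rw [one_mul]
      exact hrest (-t) s u (add_comm _ _)
        (((h t ht y).2 u huE).trans (hexp t ht _ (norm_nonneg _)))
  exact Submodule.mem_span_singleton.2 ⟨α, by rw [hu0, hs0, add_zero, add_zero]⟩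

end QuasiAnosov

theorem exists_forall_le_two_mul {α : Type*} {s : Set α} (hs : s.Nonempty) {r : α → ℝ≥0∞}
    {B : ℝ≥0∞} (hB : B ≠ ⊤) (hr : ∀ a ∈ s, r a ≤ B) : ∃ a ∈ s, ∀ b ∈ s, r b ≤ 2 * r a := by
  rcases eq_or_ne (⨆ a ∈ s, r a) 0 with h0 | h0
  · obtain ⟨a, ha⟩ := hs
    refine ⟨a, ha, fun b hb => ?_⟩
    rw [iSup₂_eq_bot.1 h0 b hb]
    exact zero_le
  · have hlt := ENNReal.half_lt_self h0 ((iSup₂_le hr).trans_lt hB.lt_top).ne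
    simp only [lt_iSup_iff] at hlt
    obtain ⟨a, ha, hlt⟩ := hlt
    refine ⟨a, ha, fun b hb => (le_iSup₂ (f := fun a (_ : a ∈ s) => r a) b hb).trans ?_⟩
    rw [mul_comm]
    exact (ENNReal.div_le_iff (by simp) (by simp)).1 hlt.le

section ShiftEDist

variable {Y : Type*} [PseudoEMetricSpace Y] {φ : Flow ℝ Y}

/-- The distance from `x'` to `x` up to a shift of `x'` along its orbit by a time at most `δ`. -/
def shiftEDist (φ : Flow ℝ Y) (δ : ℝ) (x' x : Y) : ℝ≥0∞ := ⨅ σ ∈ Icc (-δ) δ, edist (φ σ x') x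

theorem shiftEDist_le {δ σ : ℝ} (hσ : |σ| ≤ δ) (x' x : Y) :
    shiftEDist φ δ x' x ≤ edist (φ σ x') x :=
  iInf₂_le σ (abs_le.1 hσ)

theorem shiftEDist_le_edist {δ : ℝ} (hδ : 0 ≤ δ) (x' x : Y) :
    shiftEDist φ δ x' x ≤ edist x' x := by
  simpa using shiftEDist_le (φ := φ) (abs_zero.trans_le hδ) x' x

theorem shiftEDist_anti {δ δ' : ℝ} (h : δ ≤ δ') (x' x : Y) :
    shiftEDist φ δ' x' x ≤ shiftEDist φ δ x' x :=
  biInf_mono fun _ => fun hσ => Icc_subset_Icc (neg_le_neg h) h hσ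

theorem exists_edist_eq_shiftEDist {δ : ℝ} (hδ : 0 ≤ δ) (x' x : Y) :
    ∃ σ, |σ| ≤ δ ∧ edist (φ σ x') x = shiftEDist φ δ x' x := by
  have hcont : Continuous fun σ => edist (φ σ x') x :=
    (φ.continuous continuous_id continuous_const).edist continuous_const
  obtain ⟨σ, hσ, hmin⟩ := isCompact_Icc.exists_isMinOn
    (nonempty_Icc.2 (neg_le_self hδ)) hcont.continuousOn
  exact ⟨σ, abs_le.2 hσ, le_antisymm (le_iInf₂ hmin) (shiftEDist_le (abs_le.2 hσ) x' x)⟩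

variable {x x' : Y} {t t' δ η : ℝ} {ε : ℝ≥0∞} {L : ℝ≥0}

theorem shiftEDist_map_add_le (hδ : 0 ≤ δ) (htt : |t - t'| ≤ η) (hx : edist (φ t x) x ≤ ε)
    (hx' : edist (φ t' x') x' ≤ ε) {s : ℝ} (hL : ∀ r, |r| ≤ |s| + δ → LipschitzWith L (φ r)) :
    shiftEDist φ (δ + η) (φ (s + t) x') (φ (s + t) x) ≤
      shiftEDist φ δ (φ s x') (φ s x) + 2 * (L * ε) := by
  obtain ⟨σ, hσ, hmin⟩ := exists_edist_eq_shiftEDist (φ := φ) hδ (φ s x') (φ s x)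
  have hshift : |σ + (t' - t)| ≤ δ + η :=
    (abs_add_le _ _).trans (add_le_add hσ ((abs_sub_comm _ _).trans_le htt))
  have hr : |σ + s| ≤ |s| + δ := (abs_add_le _ _).trans (by linarith)
  calc shiftEDist φ (δ + η) (φ (s + t) x') (φ (s + t) x)
      ≤ edist (φ (σ + (t' - t)) (φ (s + t) x')) (φ (s + t) x) := shiftEDist_le hshift _ _
    _ = edist (φ (σ + s) (φ t' x')) (φ s (φ t x)) := by simp only [← φ.map_add]; ring_nf
    _ ≤ edist (φ (σ + s) (φ t' x')) (φ (σ + s) x') + edist (φ (σ + s) x') (φ s x) +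
          edist (φ s x) (φ s (φ t x)) := edist_triangle4 _ _ _ _
    _ ≤ L * ε + shiftEDist φ δ (φ s x') (φ s x) + L * ε := by
        gcongr
        · exact ((hL _ hr).edist_le_mul _ _).trans (by gcongr)
        · rw [φ.map_add, hmin]
        · rw [edist_comm]
          exact ((hL _ (le_add_of_nonneg_right hδ)).edist_le_mul _ _).trans (by gcongr)
    _ = _ := by ring

theorem shiftEDist_le_map_add (hδ : 0 ≤ δ) (htt : |t - t'| ≤ η) (hx : edist (φ t x) x ≤ ε)
    (hx' : edist (φ t' x') x' ≤ ε) {s : ℝ} (hL : ∀ r, |r| ≤ |s| + δ + η → LipschitzWith L (φ r)) :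
    shiftEDist φ (δ + η) (φ s x') (φ s x) ≤
      shiftEDist φ δ (φ (s + t) x') (φ (s + t) x) + 2 * (L * ε) := by
  have hη : 0 ≤ η := (abs_nonneg _).trans htt
  obtain ⟨σ, hσ, hmin⟩ := exists_edist_eq_shiftEDist (φ := φ) hδ (φ (s + t) x') (φ (s + t) x)
  have hshift : |σ + (t - t')| ≤ δ + η := (abs_add_le _ _).trans (add_le_add hσ htt)
  have hr : |σ + (t - t') + s| ≤ |s| + δ + η := (abs_add_le _ _).trans (by linarith)
  calc shiftEDist φ (δ + η) (φ s x') (φ s x)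
      ≤ edist (φ (σ + (t - t')) (φ s x')) (φ s x) := shiftEDist_le hshift _ _
    _ ≤ edist (φ (σ + (t - t') + s) x') (φ (σ + (t - t') + s) (φ t' x')) +
          edist (φ σ (φ (s + t) x')) (φ (s + t) x) + edist (φ s (φ t x)) (φ s x) := by
        refine (edist_triangle4 _ (φ (σ + (t - t') + s) (φ t' x')) (φ s (φ t x)) _).trans_eq ?_
        simp only [← φ.map_add]
        ring_nf
    _ ≤ L * ε + shiftEDist φ δ (φ (s + t) x') (φ (s + t) x) + L * ε := by
        gcongr
        · rw [edist_comm]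
          exact ((hL _ hr).edist_le_mul _ _).trans (by gcongr)
        · exact hmin.le
        · exact ((hL _ (by linarith)).edist_le_mul _ _).trans (by gcongr)
    _ = _ := by ring

theorem shiftEDist_le_of_mem_Icc_add {t₀ c : ℝ} {D : ℝ≥0∞} (ht₀ : 0 ≤ t₀) (ht : t₀ ≤ t)
    (hc : 0 ≤ c) (hδ : 0 ≤ δ) (htt : |t - t'| ≤ η) (hx : edist (φ t x) x ≤ ε)
    (hx' : edist (φ t' x') x' ≤ ε)
    (hL : ∀ r, |r| ≤ c + t₀ + δ + η → LipschitzWith L (φ r))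
    (h : ∀ s ∈ Icc (-c) (t + c), shiftEDist φ δ (φ s x') (φ s x) ≤ D) {s : ℝ}
    (hs : s ∈ Icc (-(c + t₀)) (t + (c + t₀))) :
    shiftEDist φ (δ + η) (φ s x') (φ s x) ≤ D + 2 * (L * ε) := by
  have hη : 0 ≤ η := (abs_nonneg _).trans htt
  rcases lt_or_ge (t + c) s with hlt | hle
  · have habs : |s - t| ≤ c + t₀ := abs_le.2 ⟨by linarith, by linarith [hs.2]⟩
    have := shiftEDist_map_add_le (s := s - t) hδ htt hx hx' fun r hr => hL r (by linarith)
    rw [sub_add_cancel] at this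
    exact this.trans (by gcongr; exact h _ ⟨by linarith, by linarith [hs.2]⟩)
  rcases lt_or_ge s (-c) with hlt' | hle'
  · have habs : |s| ≤ c + t₀ := abs_le.2 ⟨by linarith [hs.1], by linarith⟩
    refine (shiftEDist_le_map_add hδ htt hx hx' fun r hr => hL r (by linarith)).trans ?_
    gcongr
    exact h _ ⟨by linarith [hs.1], by linarith⟩
  · exact (shiftEDist_anti (le_add_of_nonneg_right hη) _ _).trans
      ((h s ⟨hle', hle⟩).trans le_self_add)

/-- Each orbit nearly repeats itself after one return time, and the additional shift `η` allowed in
each step absorbs the difference of the two return times. -/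
theorem shiftEDist_le_of_almost_closed {t₀ : ℝ} {D : ℝ≥0∞} (ht₀ : 0 ≤ t₀) (ht : t₀ ≤ t)
    (hδ : 0 ≤ δ) (htt : |t - t'| ≤ η) (hx : edist (φ t x) x ≤ ε) (hx' : edist (φ t' x') x' ≤ ε)
    (h : ∀ s ∈ Icc 0 t, shiftEDist φ δ (φ s x') (φ s x) ≤ D) (n : ℕ)
    (hL : ∀ r, |r| ≤ n * t₀ + δ + n * η → LipschitzWith L (φ r)) :
    ∀ s ∈ Icc (-(n * t₀)) (t + n * t₀),
      shiftEDist φ (δ + n * η) (φ s x') (φ s x) ≤ D + n * (2 * (L * ε)) := by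
  have hη : 0 ≤ η := (abs_nonneg _).trans htt
  induction n with
  | zero => simpa using h
  | succ n ih =>
    intro s hs
    push_cast [add_one_mul] at hs hL ⊢
    rw [← add_assoc, ← add_assoc]
    exact shiftEDist_le_of_mem_Icc_add ht₀ ht (by positivity) (by positivity) htt hx hx'
      (fun r hr => hL r (by linarith)) (ih fun r hr => hL r (by linarith)) hs

theorem shiftEDist_map_le_of_almost_closed {t₀ τ s : ℝ} {D : ℝ≥0∞} (ht₀ : 0 ≤ t₀) (ht : t₀ ≤ t)
    (htt : |t - t'| ≤ η) (hx : edist (φ t x) x ≤ ε) (hx' : edist (φ t' x') x' ≤ ε) {n : ℕ}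
    (hn : n * η ≤ δ) (hL : ∀ r, |r| ≤ n * t₀ + 2 * δ → LipschitzWith L (φ r))
    (hε : n * (2 * (L * ε)) ≤ D) (h : ∀ s ∈ Icc 0 t, shiftEDist φ δ (φ s x') (φ s x) ≤ 2 * D)
    (hs : s ∈ Icc 0 t) (hτ : |τ| ≤ n * t₀) :
    shiftEDist φ (2 * δ) (φ τ (φ s x')) (φ τ (φ s x)) ≤ 3 * D := by
  have hη : 0 ≤ η := (abs_nonneg _).trans htt
  have hδ : 0 ≤ δ := (mul_nonneg n.cast_nonneg hη).trans hn
  rw [← φ.map_add, ← φ.map_add]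
  calc shiftEDist φ (2 * δ) (φ (τ + s) x') (φ (τ + s) x)
      ≤ shiftEDist φ (δ + n * η) (φ (τ + s) x') (φ (τ + s) x) :=
        shiftEDist_anti (by linarith) _ _
    _ ≤ 2 * D + n * (2 * (L * ε)) :=
        shiftEDist_le_of_almost_closed ht₀ ht hδ htt hx hx' h n
          (fun r hr => hL r (by linarith)) _
          ⟨by linarith [hs.1, neg_le_of_abs_le hτ], by linarith [hs.2, le_of_abs_le hτ]⟩
    _ ≤ 2 * D + D := by gcongr
    _ = 3 * D := by ring

theorem shiftEDist_map_le (σ : ℝ) (x' x : Y) :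
    shiftEDist φ (δ + |σ|) (φ σ x') x ≤ shiftEDist φ δ x' x := by
  refine le_iInf₂ fun ρ hρ => (shiftEDist_le (σ := ρ - σ) ?_ _ _).trans_eq ?_
  · exact (abs_sub _ _).trans (add_le_add_left (abs_le.2 hρ) _)
  · rw [← φ.map_add, sub_add_cancel]

end ShiftEDist

theorem tendsto_zero_of_le_mul_enorm {ι : Type*} {l : Filter ι} {M : ι → ℝ} {f : ι → ℝ≥0∞}
    {C : ℝ≥0} (hM : Tendsto M l (𝓝 0)) (hf : ∀ᶠ j in l, f j ≤ C * ‖M j‖ₑ) : Tendsto f l (𝓝 0) := by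
  have hCM := ENNReal.Tendsto.const_mul (a := C) hM.enorm (.inr ENNReal.coe_ne_top)
  rw [enorm_zero, mul_zero] at hCM
  exact tendsto_of_tendsto_of_tendsto_of_le_of_le' tendsto_const_nhds hCM
    (.of_forall fun _ => zero_le) hf

theorem tendsto_zero_of_le_ofReal_one_div {f : ℕ → ℝ≥0∞}
    (hf : ∀ j : ℕ, f j ≤ ENNReal.ofReal (1 / ((j : ℝ) + 1))) : Tendsto f atTop (𝓝 0) :=
  tendsto_of_tendsto_of_tendsto_of_le_of_le tendsto_const_nhds
    (by simpa using ENNReal.tendsto_ofReal (tendsto_one_div_add_atTop_nhds_zero_nat (𝕜 := ℝ)))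
    (fun _ => zero_le) hf

theorem eventually_mul_le_of_add_one_mul_le_two_mul {f g : ℕ → ℝ≥0∞}
    (h : ∀ j : ℕ, (j + 1) * f j ≤ 2 * g j) (C : ℝ≥0) : ∀ᶠ j in atTop, C * f j ≤ g j := by
  filter_upwards [eventually_ge_atTop ⌈2 * C⌉₊] with j hj
  have hCj : 2 * (C : ℝ≥0∞) ≤ j + 1 := by
    exact_mod_cast (Nat.ceil_le.1 hj).trans (le_add_of_nonneg_right zero_le_one)
  refine (ENNReal.mul_le_mul_iff_right two_ne_zero (by simp)).1 (le_trans ?_ (h j))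
  rw [← mul_assoc]
  gcongr

section Closing

variable {m : ℕ} {Y : Type*} [PseudoEMetricSpace Y] [CompactSpace Y]
  [ChartedSpace (EuclideanSpace ℝ (Fin m)) Y]
  [RiemannianBundle fun y : Y => TangentSpace (𝓡 m) y] [IsManifold (𝓡 m) ∞ Y]
  [IsContinuousRiemannianBundle (EuclideanSpace ℝ (Fin m)) fun y : Y => TangentSpace (𝓡 m) y]
  [IsRiemannianManifold (𝓡 m) Y] {φ : Flow ℝ Y} {V : ∀ y : Y, TangentSpace (𝓡 m) y}
  {ι : Type*} {l : Ultrafilter ι} {M : ι → ℝ} {a a' : ι → Y} {δ : ℝ} {K R : ℝ≥0}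

theorem IsFlowOf.exists_nnnorm_mfderiv_add_smul_le (hφ : IsFlowOf φ V) (hδ : 0 ≤ δ)
    (hspeed : ∀ x β, |β| ≤ δ → ‖β‖ₑ ≤ K * edist (φ β x) x) {p : Y} {w : TangentSpace (𝓡 m) p}
    {R' : ℝ≥0} (hM : Tendsto M l (𝓝 0)) (hd : IsDisplacement (𝓡 m) l M a a' p w)
    (haa : ∀ᶠ j in (l : Filter ι), edist (a' j) (a j) ≤ R' * ‖M j‖ₑ) {τ : ℝ}
    (h : ∀ᶠ j in (l : Filter ι), shiftEDist φ δ (φ τ (a' j)) (φ τ (a j)) ≤ R * ‖M j‖ₑ) :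
    ∃ b : ℝ, ‖mfderiv (𝓡 m) (𝓡 m) (φ τ) p w + b • V (φ τ p)‖₊ ≤ R := by
  obtain ⟨L, hL⟩ := hφ.exists_lipschitzWith |τ|
  choose β hβδ hβ using fun j => exists_edist_eq_shiftEDist (φ := φ) hδ (φ τ (a' j)) (φ τ (a j))
  have hβM : ∀ᶠ j in (l : Filter ι), ‖β j‖ₑ ≤ ↑(K * (R + L * R')) * ‖M j‖ₑ := by
    filter_upwards [h, haa] with j hj hj'
    calc ‖β j‖ₑ ≤ K * edist (φ (β j) (φ τ (a' j))) (φ τ (a' j)) := hspeed _ _ (hβδ j)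
      _ ≤ K * (edist (φ (β j) (φ τ (a' j))) (φ τ (a j)) +
            edist (φ τ (a j)) (φ τ (a' j))) := by gcongr; exact edist_triangle _ _ _
      _ ≤ K * (R * ‖M j‖ₑ + L * (R' * ‖M j‖ₑ)) := by
          gcongr
          · exact (hβ j).trans_le hj
          · rw [edist_comm]
            exact (hL τ le_rfl).edist_le_mul_of_le hj'
      _ = _ := by push_cast; ring
  obtain ⟨b, -, hb⟩ := (isCompact_closedBall (0 : ℝ) (K * (R + L * R'))).ultrafilter_le_nhds
    (l.map fun j => (M j)⁻¹ * β j) <| le_principal_iff.2 <| hβM.mono fun j hj =>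
      mem_closedBall_zero_iff.2 (by exact_mod_cast nnnorm_inv_smul_le hj)
  have hβ0 : Tendsto β l (𝓝 0) :=
    tendsto_zero_iff_enorm_tendsto_zero.2 (tendsto_zero_of_le_mul_enorm hM hβM)
  refine ⟨b, (hφ.isDisplacement_flow hd hβ0 hb τ).nnnorm_le (h.mono fun j hj => ?_)⟩
  rw [add_comm, φ.map_add, hβ]
  exact hj

/-- The rescaled displacement from `a` to `a'` stays bounded for all times, up to a multiple of the
vector field, so that it is a multiple of the vector field and can be removed by a time shift. -/
theorem IsQuasiAnosov.eventually_shiftEDist_le (hQ : IsQuasiAnosov φ V) (hφ : IsFlowOf φ V)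
    (hδ : 0 ≤ δ) (hspeed : ∀ x β, |β| ≤ 2 * δ → ‖β‖ₑ ≤ K * edist (φ β x) x)
    (hM : Tendsto M l (𝓝 0)) (hM0 : ∀ᶠ j in (l : Filter ι), M j ≠ 0)
    (haa : Tendsto (fun j => edist (a' j) (a j)) l (𝓝 0))
    (h : ∀ τ, ∀ᶠ j in (l : Filter ι), shiftEDist φ δ (φ τ (a' j)) (φ τ (a j)) ≤ R * ‖M j‖ₑ)
    {η : ℝ} (hη : 0 < η) {θ : ℝ≥0} (hθ : 0 < θ) :
    ∀ᶠ j in (l : Filter ι), shiftEDist φ η (a' j) (a j) ≤ θ * ‖M j‖ₑ := by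
  obtain ⟨p, -, hp⟩ := isCompact_univ.ultrafilter_le_nhds (l.map a) (by simp)
  choose σ hσδ hσ using fun j => exists_edist_eq_shiftEDist (φ := φ) hδ (a' j) (a j)
  have hc : ∀ᶠ j in (l : Filter ι), edist (φ (σ j) (a' j)) (a j) ≤ R * ‖M j‖ₑ := by
    simpa only [hσ, φ.map_zero_apply] using h 0
  have hc0 := tendsto_zero_of_le_mul_enorm hM hc
  have hσ0 : Tendsto σ l (𝓝 0) := by
    have hsum : Tendsto (fun j => K * (edist (φ (σ j) (a' j)) (a j) + edist (a' j) (a j))) l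
        (𝓝 0) := by
      simpa using ENNReal.Tendsto.const_mul (a := K) (hc0.add haa) (.inr ENNReal.coe_ne_top)
    refine tendsto_zero_iff_enorm_tendsto_zero.2 <|
      tendsto_of_tendsto_of_tendsto_of_le_of_le tendsto_const_nhds hsum (fun _ => zero_le)
        fun j => (hspeed (a' j) _ ((hσδ j).trans (by linarith))).trans ?_
    gcongr
    exact edist_triangle_right _ _ _
  have hpc : Tendsto (fun j => φ (σ j) (a' j)) l (𝓝 p) := by
    have hsum := hc0.add (tendsto_iff_edist_tendsto_0.1 hp)
    rw [zero_add] at hsum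
    exact tendsto_iff_edist_tendsto_0.2 <| tendsto_of_tendsto_of_tendsto_of_le_of_le
      tendsto_const_nhds hsum (fun _ => zero_le) fun j => edist_triangle _ _ _
  obtain ⟨w, hw⟩ := exists_isDisplacement (I := 𝓡 m) hp hpc hc
  have hwV : w ∈ Submodule.span ℝ {V p} := by
    refine hQ.2 p w ⟨R, fun τ =>
    hφ.exists_nnnorm_mfderiv_add_smul_le (by positivity) hspeed hM hw hc <|
      (h τ).mono fun j hj => ?_⟩
    rw [← φ.map_add, add_comm, φ.map_add]
    exact (shiftEDist_anti (by linarith [hσδ j]) _ _).trans ((shiftEDist_map_le _ _ _).trans hj)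
  obtain ⟨b, rfl⟩ := Submodule.mem_span_singleton.1 hwV
  have hbM : Tendsto (fun j => -b * M j) l (𝓝 0) := by simpa using hM.const_mul (-b)
  have hd := hφ.isDisplacement_flow hw hbM (b := -b) (tendsto_const_nhds.congr' <|
    hM0.mono fun j hj => by field_simp) 0
  rw [map_smul, hφ.mfderiv_vectorField, neg_smul, add_neg_cancel] at hd
  have hshift : ∀ᶠ j in (l : Filter ι), |-b * M j + σ j| ≤ η := by
    have := (hbM.add hσ0).abs
    rw [add_zero, abs_zero] at this
    exact this.eventually_le_const hη
  filter_upwards [hd.eventually_edist_le_of_zero hM0 hθ, hshift] with j hj hjη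
  rw [zero_add, ← φ.map_add, φ.map_zero_apply] at hj
  exact (shiftEDist_le hjη _ _).trans hj

theorem IsFlowOf.eventually_shiftEDist_map_le (hφ : IsFlowOf φ V) {l : Filter ι} {x x' : ι → Y}
    {t t' s η : ι → ℝ} {ε D : ι → ℝ≥0∞} {t₀ : ℝ} (ht₀ : 0 < t₀) (hδ : 0 < δ) (ht : ∀ j, t₀ ≤ t j)
    (htt : ∀ j, |t j - t' j| ≤ η j) (hη : Tendsto η l (𝓝 0))
    (hx : ∀ j, edist (φ (t j) (x j)) (x j) ≤ ε j)
    (hx' : ∀ j, edist (φ (t' j) (x' j)) (x' j) ≤ ε j)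
    (hε : ∀ C : ℝ≥0, ∀ᶠ j in l, C * ε j ≤ D j) (hs : ∀ j, s j ∈ Icc 0 (t j))
    (h : ∀ j, ∀ r ∈ Icc 0 (t j), shiftEDist φ δ (φ r (x' j)) (φ r (x j)) ≤ 2 * D j) (τ : ℝ) :
    ∀ᶠ j in l, shiftEDist φ (2 * δ) (φ τ (φ (s j) (x' j))) (φ τ (φ (s j) (x j))) ≤ 3 * D j := by
  obtain ⟨n, hn⟩ := exists_nat_ge (|τ| / t₀)
  obtain ⟨L, hL⟩ := hφ.exists_lipschitzWith (n * t₀ + 2 * δ)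
  have hnη : ∀ᶠ j in l, n * η j ≤ δ := by
    have := hη.const_mul (n : ℝ)
    rw [mul_zero] at this
    exact this.eventually_le_const hδ
  filter_upwards [hnη, hε (n * (2 * L))] with j hj hεj
  refine shiftEDist_map_le_of_almost_closed ht₀.le (ht j) (htt j) (hx j) (hx' j) hj hL ?_ (h j)
    (hs j) ((div_le_iff₀ ht₀).1 hn)
  simpa [mul_assoc] using hεj

theorem IsQuasiAnosov.exists_shiftEDist_le (hQ : IsQuasiAnosov φ V) (hφ : IsFlowOf φ V) {t₀ : ℝ}
    (ht₀ : 0 < t₀) :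
    ∃ δ > 0, ∃ K : ℝ≥0, ∀ (ε : ℝ≥0∞) (x x' : Y) (t t' : ℝ), t₀ ≤ t → |t - t'| ≤ δ →
      edist (φ t x) x ≤ ε → edist (φ t' x') x' ≤ ε →
      (∀ s ∈ Icc 0 t, edist (φ s x') (φ s x) ≤ ENNReal.ofReal δ) →
      shiftEDist φ 1 x' x ≤ K * ε := by
  by_contra! hcon
  choose ε x x' t t' ht htt hx hx' hclose hlt using
    fun j : ℕ => hcon (1 / ((j : ℝ) + 1)) Nat.one_div_pos_of_nat (j + 1)
  obtain ⟨K, δ₁, hδ₁, hspeed⟩ := hφ.exists_enorm_le_mul_edist hQ.1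
  obtain ⟨δ, hδ, hδ1, hδδ₁⟩ : ∃ δ > 0, δ ≤ 1 ∧ 2 * (2 * δ) ≤ δ₁ :=
    ⟨min 1 (δ₁ / 4), by positivity, min_le_left _ _, by linarith [min_le_right 1 (δ₁ / 4)]⟩
  let r : ℕ → ℝ → ℝ≥0∞ := fun j s => shiftEDist φ δ (φ s (x' j)) (φ s (x j))
  have hr : ∀ j, ∀ s ∈ Icc 0 (t j), r j s ≤ ENNReal.ofReal (1 / ((j : ℝ) + 1)) := fun j s hs =>
    (shiftEDist_le_edist hδ.le _ _).trans (hclose j s hs)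
  choose s hs hmax using fun j =>
    exists_forall_le_two_mul (nonempty_Icc.2 (ht₀.le.trans (ht j))) ENNReal.ofReal_ne_top (hr j)
  let l := hyperfilter ℕ
  let M : ℕ → ℝ := fun j => (r j (s j)).toReal
  have hM : ∀ j, ‖M j‖ₑ = r j (s j) := fun j =>
    Real.enorm_toReal (ne_top_of_le_ne_top ENNReal.ofReal_ne_top (hr j _ (hs j)))
  have hεM : ∀ j : ℕ, (j + 1) * ε j < 2 * r j (s j) := fun j => by
    have h0 := hmax j 0 ⟨le_rfl, ht₀.le.trans (ht j)⟩
    simp only [r, φ.map_zero_apply] at h0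
    exact_mod_cast (hlt j).trans_le ((shiftEDist_anti hδ1 _ _).trans h0)
  have hM0 : ∀ j, r j (s j) ≠ 0 := fun j h0 => by simpa [h0] using hεM j
  have hl : (l : Filter ℕ) ≤ atTop := Nat.hyperfilter_le_atTop
  obtain ⟨j, hj⟩ := (hQ.eventually_shiftEDist_le hφ (R := 3) (θ := 1 / 2) (by positivity)
    (fun x β hβ => hspeed x β (hβ.trans hδδ₁))
    (tendsto_zero_iff_enorm_tendsto_zero.2 <| (tendsto_zero_of_le_ofReal_one_div fun j =>
      (hM j).trans_le (hr j _ (hs j))).mono_left hl)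
    (.of_forall fun j => enorm_ne_zero.1 ((hM j).trans_ne (hM0 j)))
    ((tendsto_zero_of_le_ofReal_one_div fun j => hclose j _ (hs j)).mono_left hl)
    (fun τ => (Filter.Eventually.filter_mono hl (hφ.eventually_shiftEDist_map_le ht₀ hδ ht htt
      tendsto_one_div_add_atTop_nhds_zero_nat hx hx'
      (eventually_mul_le_of_add_one_mul_le_two_mul fun j => (hεM j).le) hs hmax τ)).mono
      fun j hj => by rwa [hM]) hδ (by simp)).exists
  rw [hM] at hj
  refine (hj.trans_lt ?_).ne rfl
  rw [ENNReal.coe_div two_ne_zero, mul_comm, ← mul_div_assoc, ENNReal.coe_one, mul_one]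
  exact ENNReal.half_lt_self (hM0 j) (ne_top_of_le_ne_top ENNReal.ofReal_ne_top (hr j _ (hs j)))

end Closing

section Covering

theorem measure_le_coveringNumber_mul {α X : Type*} [MeasurableSpace α] [PseudoEMetricSpace X]
    (μ : Measure α) {S : Set α} {A : Set X} {ε : ℝ≥0} (hA : Metric.coveringNumber ε A ≠ ⊤)
    {R : α → X → Prop} (hS : ∀ y ∈ S, ∃ a ∈ A, R y a) {c : ℝ≥0∞}
    (hc : ∀ x ∈ A, μ {y | ∃ a, edist a x ≤ ε ∧ R y a} ≤ c) :
    μ S ≤ Metric.coveringNumber ε A * c := by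
  obtain ⟨N, hNA, hN, hcover, hcard⟩ := Metric.exists_set_encard_eq_coveringNumber hA
  calc μ S ≤ μ (⋃ x ∈ N, {y | ∃ a, edist a x ≤ ε ∧ R y a}) := by
        refine measure_mono fun y hy => ?_
        obtain ⟨a, ha, hya⟩ := hS y hy
        obtain ⟨x, hx, hax⟩ := hcover ha
        exact mem_biUnion hx ⟨a, hax, hya⟩
    _ ≤ ∑' x : N, μ {y | ∃ a, edist a (x : X) ≤ ε ∧ R y a} := measure_biUnion_le μ hN.countable _
    _ ≤ ∑' _ : N, c := ENNReal.tsum_le_tsum fun x => hc x (hNA x.2)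
    _ = Metric.coveringNumber ε A * c := by rw [ENNReal.tsum_set_const, hcard]

theorem measure_le_coveringNumber_mul_coveringNumber_mul {α X Z : Type*} [MeasurableSpace α]
    [PseudoEMetricSpace X] [PseudoEMetricSpace Z] (μ : Measure α) {S : Set α} {A : Set X}
    {B : Set Z} {ε η : ℝ≥0} (hA : Metric.coveringNumber ε A ≠ ⊤)
    (hB : Metric.coveringNumber η B ≠ ⊤) {R : α → X → Z → Prop}
    (hS : ∀ y ∈ S, ∃ a ∈ A, ∃ b ∈ B, R y a b) {c : ℝ≥0∞}
    (hc : ∀ x ∈ A, ∀ z ∈ B, μ {y | ∃ b, edist b z ≤ η ∧ ∃ a, edist a x ≤ ε ∧ R y a b} ≤ c) :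
    μ S ≤ Metric.coveringNumber ε A * (Metric.coveringNumber η B * c) := by
  refine measure_le_coveringNumber_mul μ hA (R := fun y a => ∃ b ∈ B, R y a b) hS fun x hx =>
    measure_le_coveringNumber_mul μ hB (R := fun y b => ∃ a, edist a x ≤ ε ∧ R y a b) ?_ (hc x hx)
  rintro y ⟨a, hax, b, hb, hR⟩
  exact ⟨b, hb, a, hax, hR⟩

theorem coveringNumber_ne_top_of_isCompact {X : Type*} [PseudoEMetricSpace X] {ε : ℝ≥0} (hε : ε ≠ 0)
    {A : Set X} (hA : IsCompact A) : Metric.coveringNumber ε A ≠ ⊤ := by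
  obtain ⟨N, hNA, hN, hcover⟩ := Metric.exists_finite_isCover_of_isCompact hε hA
  exact ((hcover.coveringNumber_le_encard hNA).trans_lt hN.encard_lt_top).ne

variable {X : Type*} [PseudoEMetricSpace X] [MeasurableSpace X] [OpensMeasurableSpace X]

theorem coveringNumber_mul_le_measure (μ : Measure X) {A B : Set X} {ε : ℝ≥0} {c : ℝ≥0∞}
    (hB : ∀ x ∈ A, Metric.closedEBall x (ε / 2) ⊆ B)
    (hc : ∀ x ∈ A, c ≤ μ (Metric.closedEBall x (ε / 2))) :
    Metric.coveringNumber ε A * c ≤ μ B := by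
  have separated : ∀ N ⊆ A, Metric.IsSeparated ε N → N.encard * c ≤ μ B := by
    intro N hNA hN
    have disj : Pairwise (Function.onFun Disjoint
        fun x : N => Metric.closedEBall (x : X) (ε / 2)) := by
      intro x y hxy
      refine Set.disjoint_left.2 fun z hzx hzy => (hN x.2 y.2 (Subtype.coe_ne_coe.2 hxy)).not_ge ?_
      exact (edist_triangle_left _ _ z).trans ((add_le_add hzx hzy).trans_eq
        (ENNReal.add_halves _))
    calc N.encard * c = ∑' _ : N, c := (ENNReal.tsum_set_const N c).symm
      _ ≤ ∑' x : N, μ (Metric.closedEBall (x : X) (ε / 2)) :=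
        ENNReal.tsum_le_tsum fun x => hc x (hNA x.2)
      _ ≤ μ (⋃ x : N, Metric.closedEBall (x : X) (ε / 2)) :=
        tsum_meas_le_meas_iUnion_of_disjoint μ
          (fun x => Metric.isClosed_closedEBall.measurableSet) disj
      _ ≤ μ B := measure_mono (iUnion_subset fun x => hB x (hNA x.2))
  calc (Metric.coveringNumber ε A : ℝ≥0∞) * c ≤ (Metric.packingNumber ε A : ℝ≥0∞) * c :=
        mul_le_mul_left (ENat.toENNReal_le.2 (Metric.coveringNumber_le_packingNumber ε A)) c
    _ ≤ μ B := by
        simp only [Metric.packingNumber, ENat.toENNReal_iSup, ENNReal.iSup_mul]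
        exact iSup_le fun N => iSup₂_le (separated N)

theorem coveringNumber_Icc_mul_le {a b : ℝ} (hab : a ≤ b) (ε : ℝ≥0) :
    Metric.coveringNumber ε (Icc a b) * (ε : ℝ≥0∞) ≤ ENNReal.ofReal (b - a) + ε := by
  have hball : ∀ x : ℝ, Metric.closedEBall x (ε / 2) = Metric.closedBall x (ε / 2) := by
    intro x
    rw [← Metric.closedEBall_ofReal (by positivity), ENNReal.ofReal_div_of_pos two_pos]
    simp
  calc Metric.coveringNumber ε (Icc a b) * (ε : ℝ≥0∞)
      ≤ volume (Icc (a - ε / 2) (b + ε / 2)) := by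
        refine coveringNumber_mul_le_measure volume (fun x hx => ?_) (fun x _ => ?_)
        · rw [hball, Real.closedBall_eq_Icc]
          exact Icc_subset_Icc (by linarith [hx.1]) (by linarith [hx.2])
        · rw [hball, Real.volume_closedBall, mul_div_cancel₀ _ two_ne_zero,
            ENNReal.ofReal_coe_nnreal]
    _ = ENNReal.ofReal (b - a) + ε := by
        rw [Real.volume_Icc, ← ENNReal.ofReal_coe_nnreal,
          ← ENNReal.ofReal_add (sub_nonneg.2 hab) ε.coe_nonneg]
        ring_nf

theorem exists_coveringNumber_Icc_zero_le {ε : ℝ≥0} (hε : ε ≠ 0) :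
    ∃ C : ℝ≥0, ∀ T : ℝ, 0 ≤ T →
      (Metric.coveringNumber ε (Icc 0 T) : ℝ≥0∞) ≤ C * ENNReal.ofReal (T + 1) := by
  refine ⟨ε⁻¹ + 1, fun T hT => ?_⟩
  have hε' : (ε : ℝ≥0∞) ≠ 0 := ENNReal.coe_ne_zero.2 hε
  rw [ENNReal.ofReal_add hT zero_le_one, ENNReal.ofReal_one, ENNReal.coe_add,
    ENNReal.coe_inv hε, ENNReal.coe_one]
  calc (Metric.coveringNumber ε (Icc 0 T) : ℝ≥0∞) ≤ (ENNReal.ofReal T + ε) / ε := by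
        rw [ENNReal.le_div_iff_mul_le (.inl hε') (.inl ENNReal.coe_ne_top)]
        simpa only [sub_zero] using coveringNumber_Icc_mul_le hT ε
    _ = (ε : ℝ≥0∞)⁻¹ * ENNReal.ofReal T + 1 * 1 := by
        rw [ENNReal.add_div, ENNReal.div_self hε' ENNReal.coe_ne_top, ENNReal.div_eq_inv_mul,
          one_mul]
    _ ≤ ((ε : ℝ≥0∞)⁻¹ + 1) * (ENNReal.ofReal T + 1) := by
        rw [add_mul]
        gcongr
        · exact le_self_add
        · exact le_add_self

end Covering

section Volume

theorem exists_eventually_closedEBall_subset {X : Type*} [PseudoEMetricSpace X] {p : X}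
    {u : Set X} (hu : u ∈ 𝓝 p) :
    ∃ ρ : ℝ≥0, ρ ≠ 0 ∧ ∀ᶠ x in 𝓝 p, Metric.closedEBall x ρ ⊆ u := by
  obtain ⟨ε, hε, h⟩ := Metric.nhds_basis_closedEBall.mem_iff.1 hu
  obtain ⟨ρ, hρ, hρε⟩ := ENNReal.lt_iff_exists_nnreal_btwn.1 (ENNReal.half_pos hε.ne')
  refine ⟨ρ, (ENNReal.coe_pos.1 hρ).ne', ?_⟩
  filter_upwards [Metric.closedEBall_mem_nhds p hρ] with x hx y hy
  refine h ((edist_triangle y x p).trans ((add_le_add hy hx).trans ?_))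
  exact (add_le_add hρε.le hρε.le).trans_eq (ENNReal.add_halves ε)

section Lipschitz

variable {X Z : Type*} [EMetricSpace X] [EMetricSpace Z] [MeasurableSpace X] [BorelSpace X]
  [MeasurableSpace Z] [BorelSpace Z] {K L : ℝ≥0} {f : X → Z} {g : Z → X}

theorem euclideanHausdorffMeasure_image_le {s : Set X} (hf : LipschitzOnWith K f s) (d : ℕ) :
    Measure.euclideanHausdorffMeasure d (f '' s) ≤
      (K : ℝ≥0∞) ^ d * Measure.euclideanHausdorffMeasure d s := by
  have h := hf.hausdorffMeasure_image_le d.cast_nonneg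
  simp only [Measure.euclideanHausdorffMeasure_def, Measure.smul_apply, ENNReal.rpow_natCast,
    ENNReal.smul_def, smul_eq_mul] at h ⊢
  rw [mul_left_comm]
  gcongr

theorem exists_eventually_measure_closedEBall_le {p : X} {u : Set X} (hu : u ∈ 𝓝 p)
    (hf : LipschitzOnWith K f u) {v : Set Z} (hv : v ∈ 𝓝 (f p)) (hg : LipschitzOnWith L g v)
    (hgf : ∀ᶠ x in 𝓝 p, g (f x) = x) (d : ℕ) :
    ∃ ρ : ℝ≥0, ρ ≠ 0 ∧ ∀ᶠ x in 𝓝 p, ∀ r ≤ ρ,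
      Measure.euclideanHausdorffMeasure d (Metric.closedEBall x r) ≤
        (L : ℝ≥0∞) ^ d *
          Measure.euclideanHausdorffMeasure d (Metric.closedEBall (f x) (K * r)) := by
  have hfv : f ⁻¹' v ∈ 𝓝 p := (hf.continuousOn.continuousAt hu).preimage_mem_nhds hv
  obtain ⟨ρ, hρ, H⟩ :=
    exists_eventually_closedEBall_subset (inter_mem hu (inter_mem hfv hgf))
  refine ⟨ρ, hρ, H.mono fun x hx r hr => ?_⟩
  set B := Metric.closedEBall x (r : ℝ≥0∞)
  have hB := (Metric.closedEBall_subset_closedEBall (ENNReal.coe_le_coe.2 hr)).trans hx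
  calc Measure.euclideanHausdorffMeasure d B
      = Measure.euclideanHausdorffMeasure d (g '' (f '' B)) := by
        rw [image_image, image_congr fun y hy => (hB hy).2.2, image_id']
    _ ≤ (L : ℝ≥0∞) ^ d * Measure.euclideanHausdorffMeasure d (f '' B) :=
        euclideanHausdorffMeasure_image_le
          (hg.mono (image_subset_iff.2 fun y hy => (hB hy).2.1)) d
    _ ≤ _ := by
        gcongr
        rintro _ ⟨y, hy, rfl⟩
        exact (hf (hB hy).1 (hB Metric.mem_closedEBall_self).1).trans (by gcongr; exact hy)

end Lipschitz

variable {E : Type*} [NormedAddCommGroup E] [InnerProductSpace ℝ E] [FiniteDimensional ℝ E]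

variable (E) in
theorem exists_euclideanHausdorffMeasure_closedEBall_eq [MeasurableSpace E] [BorelSpace E] :
    ∃ b : ℝ≥0, b ≠ 0 ∧ ∀ (z : E) (r : ℝ≥0),
      Measure.euclideanHausdorffMeasure (Module.finrank ℝ E) (Metric.closedEBall z r) =
        b * (r : ℝ≥0∞) ^ Module.finrank ℝ E := by
  have hfin : volume (Metric.closedBall (0 : E) 1) ≠ ⊤ := measure_closedBall_lt_top.ne
  refine ⟨(volume (Metric.closedBall (0 : E) 1)).toNNReal, ?_, fun z r => ?_⟩
  · exact ENNReal.toNNReal_ne_zero.2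
      ⟨(Metric.measure_closedBall_pos volume (0 : E) one_pos).ne', hfin⟩
  · rw [InnerProductSpace.euclideanHausdorffMeasure_eq_volume, Metric.closedEBall_coe,
      Measure.addHaar_closedBall' _ _ r.coe_nonneg, ENNReal.ofReal_pow r.coe_nonneg,
      ENNReal.ofReal_coe_nnreal, ENNReal.coe_toNNReal hfin, mul_comm]

variable {H : Type*} [TopologicalSpace H] (I : ModelWithCorners ℝ E H) [I.Boundaryless]
  (M : Type*) [EMetricSpace M] [CompactSpace M] [ChartedSpace H M] [IsManifold I 1 M]
  [RiemannianBundle fun x : M => TangentSpace I x]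
  [IsContinuousRiemannianBundle E fun x : M => TangentSpace I x] [IsRiemannianManifold I M]
  [MeasurableSpace M] [BorelSpace M]

include I

theorem exists_riemannianVolume_closedEBall_le_of_mul_le_one :
    ∃ K : ℝ≥0, ∀ (x : M) (r : ℝ≥0), K * r ≤ 1 →
      riemannianVolume M (Module.finrank ℝ E) (Metric.closedEBall x r) ≤
        K * (r : ℝ≥0∞) ^ Module.finrank ℝ E := by
  borelize E
  suffices h : ∃ K : ℝ≥0, ∀ x ∈ (univ : Set M), ∀ r : ℝ≥0, K * r ≤ 1 →
      riemannianVolume M (Module.finrank ℝ E) (Metric.closedEBall x r) ≤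
        K * (r : ℝ≥0∞) ^ Module.finrank ℝ E by simpa using h
  refine exists_forall_of_isCompact_of_eventually isCompact_univ
    (fun x K K' hK h r hr => (h r (by grw [hK, hr])).trans (by gcongr)) fun p _ => ?_
  obtain ⟨K, u, hu, hK⟩ := exists_lipschitzOnWith_extChartAt I p
  obtain ⟨L, v, hv, hL⟩ := exists_lipschitzOnWith_extChartAt_symm I p
  obtain ⟨ρ, hρ, H⟩ := exists_eventually_measure_closedEBall_le hu hK hv hL
    (eventually_of_mem (extChartAt_source_mem_nhds p) fun x => (extChartAt I p).left_inv)
    (Module.finrank ℝ E)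
  obtain ⟨b, -, hb⟩ := exists_euclideanHausdorffMeasure_closedEBall_eq E
  refine ⟨max ρ⁻¹ (L ^ Module.finrank ℝ E * (b * K ^ Module.finrank ℝ E)),
    H.mono fun x hx r hr => ?_⟩
  have hrρ : r ≤ ρ := by
    have := (mul_le_mul_left (le_max_left ρ⁻¹ _) r).trans hr
    rwa [inv_mul_le_iff₀ (pos_iff_ne_zero.2 hρ), mul_one] at this
  refine (hx r hrρ).trans ?_
  rw [← ENNReal.coe_mul, hb, ENNReal.coe_mul, mul_pow, ← mul_assoc, ← mul_assoc, mul_assoc (_ ^ _)]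
  gcongr
  exact_mod_cast le_max_right _ _

theorem exists_pow_le_riemannianVolume_closedEBall_mul :
    ∃ K : ℝ≥0, ∀ (x : M) (r : ℝ≥0), r ≤ 1 →
      (r : ℝ≥0∞) ^ Module.finrank ℝ E ≤
        K * riemannianVolume M (Module.finrank ℝ E) (Metric.closedEBall x (K * r)) := by
  borelize E
  suffices h : ∃ K : ℝ≥0, ∀ x ∈ (univ : Set M), ∀ r : ℝ≥0, r ≤ 1 →
      (r : ℝ≥0∞) ^ Module.finrank ℝ E ≤
        K * riemannianVolume M (Module.finrank ℝ E) (Metric.closedEBall x (K * r)) by simpa using h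
  refine exists_forall_of_isCompact_of_eventually isCompact_univ
    (fun x K K' hK h r hr => (h r hr).trans (by gcongr)) fun p _ => ?_
  obtain ⟨K, u, hu, hK⟩ := exists_lipschitzOnWith_extChartAt_symm I p
  obtain ⟨L, v, hv, hL⟩ := exists_lipschitzOnWith_extChartAt I p
  obtain ⟨ρ, hρ, H⟩ := exists_eventually_measure_closedEBall_le hu hK
    (by rwa [extChartAt_to_inv]) hL
    (eventually_of_mem (extChartAt_target_mem_nhds p) fun x => (extChartAt I p).right_inv)
    (Module.finrank ℝ E)
  obtain ⟨b, hb0, hb⟩ := exists_euclideanHausdorffMeasure_closedEBall_eq E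
  refine ⟨max (K * ρ) ((b * ρ ^ Module.finrank ℝ E)⁻¹ * L ^ Module.finrank ℝ E), ?_⟩
  have hc : b * ρ ^ Module.finrank ℝ E ≠ 0 := mul_ne_zero hb0 (pow_ne_zero _ hρ)
  filter_upwards [(continuousAt_extChartAt (I := I) p).eventually H,
    extChartAt_source_mem_nhds (I := I) p] with x hx hxp r hr
  have h := hx (ρ * r) (mul_le_of_le_one_right' hr)
  rw [(extChartAt I p).left_inv hxp, hb] at h
  calc (r : ℝ≥0∞) ^ Module.finrank ℝ E
      = ((b * ρ ^ Module.finrank ℝ E)⁻¹ : ℝ≥0) *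
          (b * ((ρ * r : ℝ≥0) : ℝ≥0∞) ^ Module.finrank ℝ E) := by
        norm_cast
        rw [mul_pow, ← mul_assoc b, inv_mul_cancel_left₀ hc]
    _ ≤ ((b * ρ ^ Module.finrank ℝ E)⁻¹ : ℝ≥0) * (L ^ Module.finrank ℝ E *
          riemannianVolume M (Module.finrank ℝ E) (Metric.closedEBall x (K * (ρ * r : ℝ≥0)))) := by
        exact mul_le_mul_right h _
    _ ≤ _ := by
        rw [← mul_assoc, ENNReal.coe_mul ρ, ← mul_assoc (K : ℝ≥0∞)]
        gcongr
        · exact_mod_cast le_max_right _ _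
        · exact_mod_cast le_max_left _ _

theorem exists_pow_le_riemannianVolume_closedEBall :
    ∃ K : ℝ≥0, ∀ (x : M) (r : ℝ≥0), r ≤ 1 →
      (r : ℝ≥0∞) ^ Module.finrank ℝ E ≤
        K * riemannianVolume M (Module.finrank ℝ E) (Metric.closedEBall x r) := by
  obtain ⟨K, hK⟩ := exists_pow_le_riemannianVolume_closedEBall_mul (E := E) I M
  have hK1 : (1 : ℝ≥0) ≤ K + 1 := le_add_self
  refine ⟨(K + 1) ^ Module.finrank ℝ E * K, fun x r hr => ?_⟩
  have hr' : r = (K + 1) * (r / (K + 1)) := (mul_div_cancel₀ r (by positivity)).symm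
  calc (r : ℝ≥0∞) ^ Module.finrank ℝ E
      = ((K + 1) ^ Module.finrank ℝ E : ℝ≥0) *
          ((r / (K + 1) : ℝ≥0) : ℝ≥0∞) ^ Module.finrank ℝ E := by
        rw [ENNReal.coe_pow, ← mul_pow, ← ENNReal.coe_mul, ← hr']
    _ ≤ _ := by
        rw [ENNReal.coe_mul, mul_assoc]
        gcongr
        refine (hK x _ (div_le_one_of_le₀ (hr.trans hK1) zero_le)).trans ?_
        gcongr
        rw [← ENNReal.coe_mul, ENNReal.coe_le_coe]
        nth_rw 2 [hr']
        gcongr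
        exact le_self_add

theorem riemannianVolume_univ_ne_top :
    riemannianVolume M (Module.finrank ℝ E) (univ : Set M) ≠ ⊤ := by
  obtain ⟨K, hK⟩ := exists_riemannianVolume_closedEBall_le_of_mul_le_one (E := E) I M
  refine (isCompact_univ.measure_lt_top_of_nhdsWithin fun x _ => ?_).ne
  have hr : K * (K + 1)⁻¹ ≤ 1 := by
    rw [← div_eq_mul_inv]
    exact div_le_one_of_le₀ le_self_add zero_le
  refine ⟨Metric.closedEBall x ((K + 1)⁻¹ : ℝ≥0), mem_nhdsWithin_of_mem_nhds
    (Metric.closedEBall_mem_nhds x (ENNReal.coe_pos.2 (by positivity))), ?_⟩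
  exact (hK x _ hr).trans_lt (by finiteness)

theorem exists_riemannianVolume_closedEBall_le :
    ∃ K : ℝ≥0, ∀ (x : M) (r : ℝ≥0),
      riemannianVolume M (Module.finrank ℝ E) (Metric.closedEBall x r) ≤
        K * (r : ℝ≥0∞) ^ Module.finrank ℝ E := by
  obtain ⟨K, hK⟩ := exists_riemannianVolume_closedEBall_le_of_mul_le_one (E := E) I M
  lift riemannianVolume M (Module.finrank ℝ E) (univ : Set M) to ℝ≥0
    using riemannianVolume_univ_ne_top (E := E) I M with v hv
  refine ⟨max K (v * K ^ Module.finrank ℝ E), fun x r => ?_⟩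
  rcases le_total (K * r) 1 with hr | hr
  · exact (hK x r hr).trans (by gcongr; exact le_max_left _ _)
  · calc riemannianVolume M (Module.finrank ℝ E) (Metric.closedEBall x r) ≤ v * 1 :=
          (measure_mono (subset_univ _)).trans_eq (by rw [mul_one, hv])
      _ ≤ v * ((K * r : ℝ≥0) : ℝ≥0∞) ^ Module.finrank ℝ E := by
          gcongr
          exact one_le_pow₀ (ENNReal.one_le_coe_iff.2 hr)
      _ ≤ _ := by
          rw [ENNReal.coe_mul, mul_pow, ← mul_assoc]
          gcongr
          exact_mod_cast le_max_right _ _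

omit [MeasurableSpace M] [BorelSpace M] in
theorem exists_coveringNumber_mul_pow_le :
    ∃ C : ℝ≥0, ∀ r : ℝ≥0, r ≤ 1 →
      Metric.coveringNumber r (univ : Set M) * (r : ℝ≥0∞) ^ Module.finrank ℝ E ≤ C := by
  borelize M
  obtain ⟨K, hK⟩ := exists_pow_le_riemannianVolume_closedEBall (E := E) I M
  lift riemannianVolume M (Module.finrank ℝ E) (univ : Set M) to ℝ≥0
    using riemannianVolume_univ_ne_top (E := E) I M with v hv
  refine ⟨2 ^ Module.finrank ℝ E * (K * v), fun r hr => ?_⟩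
  have hr2 : ((r / 2 : ℝ≥0) : ℝ≥0∞) = r / 2 := ENNReal.coe_div two_ne_zero
  have h : Metric.coveringNumber r (univ : Set M) *
      ((r / 2 : ℝ≥0) : ℝ≥0∞) ^ Module.finrank ℝ E ≤ K * v := by
    rw [hv]
    refine coveringNumber_mul_le_measure (K • riemannianVolume M (Module.finrank ℝ E))
      (fun x _ => subset_univ _) fun x _ => ?_
    rw [← hr2]
    exact hK x _ ((half_le_self zero_le).trans hr)
  calc Metric.coveringNumber r (univ : Set M) * (r : ℝ≥0∞) ^ Module.finrank ℝ E
      = 2 ^ Module.finrank ℝ E * (Metric.coveringNumber r (univ : Set M) *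
          ((r / 2 : ℝ≥0) : ℝ≥0∞) ^ Module.finrank ℝ E) := by
        rw [mul_left_comm, ← mul_pow, hr2, ENNReal.mul_div_cancel two_ne_zero ENNReal.ofNat_ne_top]
    _ ≤ 2 ^ Module.finrank ℝ E * (K * v) := by gcongr
    _ = _ := by push_cast; rfl

end Volume

section Expansion

variable {m : ℕ} {Y : Type*} [TopologicalSpace Y] [ChartedSpace (EuclideanSpace ℝ (Fin m)) Y]
  [RiemannianBundle fun y : Y => TangentSpace (𝓡 m) y] {φ : Flow ℝ Y} {l : ℝ}

theorem eventually_norm_mfderiv_le_exp (hl : maximalExpansionRate m φ < (l : EReal)) :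
    ∀ᶠ t : ℝ in atTop, ∀ y : Y, ‖mfderiv (𝓡 m) (𝓡 m) (φ t) y‖ ≤ Real.exp (l * t) := by
  filter_upwards [eventually_lt_of_limsup_lt hl, eventually_gt_atTop 0] with t ht ht0 y
  have hlog := (le_iSup (fun y : Y =>
    ((t⁻¹ * Real.log ‖mfderiv (𝓡 m) (𝓡 m) (φ t) y‖ : ℝ) : EReal)) y).trans_lt ht
  rw [EReal.coe_lt_coe_iff, inv_mul_lt_iff₀ ht0, mul_comm] at hlog
  rcases (norm_nonneg (mfderiv (𝓡 m) (𝓡 m) (φ t) y)).eq_or_lt with h | h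
  · exact h.symm.trans_le (Real.exp_pos _).le
  · exact (Real.log_le_iff_le_exp h).1 hlog.le

theorem IsFlowOf.expansionRate_nonneg [CompactSpace Y] [Nonempty Y] [IsManifold (𝓡 m) ∞ Y]
    [IsContinuousRiemannianBundle (EuclideanSpace ℝ (Fin m)) fun y : Y => TangentSpace (𝓡 m) y]
    {V : ∀ y : Y, TangentSpace (𝓡 m) y} (hφ : IsFlowOf φ V) (hV : ∀ y, V y ≠ 0)
    (hl : maximalExpansionRate m φ < (l : EReal)) : 0 ≤ l := by
  obtain ⟨K, hK⟩ := hφ.exists_nnnorm_vectorField_le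
  obtain ⟨κ, hκ, hκV⟩ := hφ.exists_pos_forall_le_norm_vectorField hV
  by_contra! hneg
  have hlim : Tendsto (fun t : ℝ => Real.exp (l * t) * K) atTop (𝓝 0) := by
    simpa using (Real.tendsto_exp_atBot.comp
      (tendsto_id.const_mul_atTop_of_neg hneg)).mul_const (K : ℝ)
  obtain ⟨t, hexp, hlt⟩ := ((eventually_norm_mfderiv_le_exp hl).and
    (hlim.eventually_lt_const hκ)).exists
  obtain ⟨y⟩ := ‹Nonempty Y›
  have hle : ‖V (φ t y)‖ ≤ Real.exp (l * t) * K := by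
    rw [← hφ.mfderiv_vectorField]
    exact (mfderiv (𝓡 m) (𝓡 m) (φ t) y).le_of_opNorm_le_of_le (hexp y) (hK y)
  exact ((hκV _).trans hle).not_gt hlt

end Expansion

section ExpansionDistance

variable {m : ℕ} {Y : Type*} [PseudoEMetricSpace Y] [CompactSpace Y]
  [ChartedSpace (EuclideanSpace ℝ (Fin m)) Y]
  [RiemannianBundle fun y : Y => TangentSpace (𝓡 m) y] [IsManifold (𝓡 m) ∞ Y]
  [IsContinuousRiemannianBundle (EuclideanSpace ℝ (Fin m)) fun y : Y => TangentSpace (𝓡 m) y]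
  [IsRiemannianManifold (𝓡 m) Y] {φ : Flow ℝ Y} {V : ∀ y : Y, TangentSpace (𝓡 m) y} {l : ℝ}

theorem IsFlowOf.exists_lipschitzWith_mul_exp (hφ : IsFlowOf φ V) (hl0 : 0 ≤ l)
    (hl : maximalExpansionRate m φ < (l : EReal)) :
    ∃ K : ℝ≥0, ∀ t, 0 ≤ t → LipschitzWith (K * (Real.exp (l * t)).toNNReal) (φ t) := by
  obtain ⟨N, hN⟩ := eventually_atTop.1 (eventually_norm_mfderiv_le_exp hl)
  obtain ⟨K, hK⟩ := hφ.exists_lipschitzWith N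
  refine ⟨max 1 K, fun t ht => ?_⟩
  rcases le_total t N with htN | htN
  · have hexp : 1 ≤ (Real.exp (l * t)).toNNReal := by
      rw [Real.one_le_toNNReal]
      exact Real.one_le_exp (by positivity)
    exact (hK t (by rwa [abs_of_nonneg ht])).weaken
      ((le_max_right 1 K).trans (le_mul_of_one_le_right' hexp))
  · refine (lipschitzWith_of_nnnorm_mfderiv_le (𝓡 m) (𝓡 m) (K := (Real.exp (l * t)).toNNReal)
      (by simp [Real.exp_pos]) ((hφ.contMDiff_time t).of_le (by simp)) fun y => ?_).weaken
      (le_mul_of_one_le_left' (le_max_left 1 K))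
    rw [Real.le_toNNReal_iff_coe_le (Real.exp_pos _).le]
    exact hN t htN y

theorem IsFlowOf.exists_forall_edist_map_le (hφ : IsFlowOf φ V) (hl0 : 0 ≤ l)
    (hl : maximalExpansionRate m φ < (l : EReal)) {δ : ℝ≥0} (hδ : δ ≠ 0) :
    ∃ ρ : ℝ≥0, ρ ≠ 0 ∧ ρ ≤ 1 ∧ ∀ (T : ℝ) (x x' : Y),
      edist x' x ≤ 2 * (ρ * (Real.exp (-(l * T))).toNNReal : ℝ≥0) →
      ∀ s ∈ Icc 0 T, edist (φ s x') (φ s x) ≤ δ := by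
  obtain ⟨K, hK⟩ := hφ.exists_lipschitzWith_mul_exp hl0 hl
  refine ⟨min 1 (δ / (2 * (K + 1))), ?_, min_le_left _ _, fun T x x' h s hs => ?_⟩
  · positivity
  have hexp : (Real.exp (l * s)).toNNReal * (Real.exp (-(l * T))).toNNReal ≤ 1 := by
    rw [← Real.toNNReal_mul (Real.exp_pos _).le, ← Real.exp_add, Real.toNNReal_le_one,
      Real.exp_le_one_iff]
    linarith [mul_le_mul_of_nonneg_left hs.2 hl0]
  refine ((hK s hs.1).edist_le_mul _ _).trans ?_
  grw [h]
  norm_cast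
  set ρ := min 1 (δ / (2 * (K + 1)))
  have hρ : ρ * (2 * (K + 1)) ≤ δ := (le_div_iff₀ (by positivity)).1 (min_le_right _ _)
  calc K * (Real.exp (l * s)).toNNReal * (2 * (ρ * (Real.exp (-(l * T))).toNNReal))
      = ρ * (2 * K) * ((Real.exp (l * s)).toNNReal * (Real.exp (-(l * T))).toNNReal) := by ring
    _ ≤ ρ * (2 * (K + 1)) * 1 := by gcongr; exact le_self_add
    _ ≤ δ := by rwa [mul_one]

theorem IsFlowOf.exists_pos_le_of_half_shortestPeriod_le (hφ : IsFlowOf φ V)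
    (hV : ∀ y, V y ≠ 0) :
    ∃ t₀ > 0, ∀ t : ℝ, shortestPeriod φ / 2 ≤ ENNReal.ofReal t → t₀ ≤ t := by
  obtain ⟨K, δ, hδ, hspeed⟩ := hφ.exists_enorm_le_mul_edist hV
  have hperiod : ENNReal.ofReal δ ≤ shortestPeriod φ := by
    refine le_iInf₂ fun s hs => ENNReal.ofReal_le_ofReal ?_
    obtain ⟨hs0, y, hy⟩ := hs
    by_contra! hlt
    have hs := hspeed y s (by rw [abs_of_pos hs0]; exact hlt.le)
    rw [hy, edist_self, mul_zero, nonpos_iff_eq_zero, enorm_eq_zero] at hs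
    exact hs0.ne' hs
  refine ⟨δ / 2, half_pos hδ, fun t ht => ?_⟩
  have hle : ENNReal.ofReal (δ / 2) ≤ ENNReal.ofReal t := by
    rw [ENNReal.ofReal_div_of_pos two_pos, ENNReal.ofReal_ofNat]
    exact (ENNReal.div_le_div_right hperiod 2).trans ht
  exact (ENNReal.ofReal_le_ofReal_iff'.1 hle).resolve_right (half_pos hδ).not_ge

end ExpansionDistance

section Counting

variable {m : ℕ} {Y : Type*} [EMetricSpace Y] [CompactSpace Y]
  [ChartedSpace (EuclideanSpace ℝ (Fin m)) Y]
  [RiemannianBundle fun y : Y => TangentSpace (𝓡 m) y] [IsManifold (𝓡 m) ∞ Y]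
  [IsContinuousRiemannianBundle (EuclideanSpace ℝ (Fin m)) fun y : Y => TangentSpace (𝓡 m) y]
  [IsRiemannianManifold (𝓡 m) Y] {φ : Flow ℝ Y} {V : ∀ y : Y, TangentSpace (𝓡 m) y} {l t₀ : ℝ}

theorem IsFlowOf.exists_volume_slice_le (hφ : IsFlowOf φ V) (hV : ∀ y, V y ≠ 0) :
    ∃ C : ℝ≥0, ∀ (T : ℝ) (ε : ℝ≥0) (y : Y), 0 ≤ T →
      volume (Prod.mk y ⁻¹' liftedRecurrenceSet φ T ε) ≤ C * ENNReal.ofReal (T + 1) * ε := by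
  obtain ⟨K, δ, hδ, hspeed⟩ := hφ.exists_enorm_le_mul_edist hV
  lift δ to ℝ≥0 using hδ.le
  have hδ2 : δ / 2 ≠ 0 := (half_pos (NNReal.coe_pos.1 hδ)).ne'
  obtain ⟨C, hC⟩ := exists_coveringNumber_Icc_zero_le hδ2
  refine ⟨C * (K * 2), fun T ε y hT => ?_⟩
  suffices hslab : ∀ t ∈ Icc 0 T, volume {s : ℝ | ∃ a, edist a t ≤ (δ / 2 : ℝ≥0) ∧
      a = s ∧ edist (φ s y) y ≤ ε} ≤ K * (2 * ε) by
    calc volume (Prod.mk y ⁻¹' liftedRecurrenceSet φ T ε)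
        ≤ Metric.coveringNumber (δ / 2) (Icc 0 T) * (K * (2 * (ε : ℝ≥0∞))) := by
          refine measure_le_coveringNumber_mul volume
            (coveringNumber_ne_top_of_isCompact hδ2 isCompact_Icc)
            (fun s hs => ⟨s, ⟨hs.1, hs.2.2.1⟩, rfl, ?_⟩) hslab
          simpa using hs.2.2.2
      _ ≤ C * ENNReal.ofReal (T + 1) * (K * (2 * ε)) := by gcongr; exact hC T hT
      _ = _ := by push_cast; ring
  refine fun t _ => (Real.volume_le_diam _).trans (Metric.ediam_le ?_)
  rintro _ ⟨s, hst, rfl, hs⟩ _ ⟨s', hst', rfl, hs'⟩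
  have hdist : |s - s'| ≤ δ := by
    have := (edist_triangle_right s s' t).trans (add_le_add hst hst')
    rw [← ENNReal.coe_add, add_halves, edist_nndist, ENNReal.coe_le_coe] at this
    exact_mod_cast this
  calc edist s s' = ‖s - s'‖ₑ := edist_eq_enorm_sub s s'
    _ ≤ K * edist (φ (s - s') (φ s' y)) (φ s' y) := hspeed _ _ hdist
    _ = K * edist (φ s y) (φ s' y) := by rw [← φ.map_add, sub_add_cancel]
    _ ≤ K * (2 * ε) := by
        grw [edist_triangle_right (φ s y) (φ s' y) y, hs, hs', two_mul]

theorem IsFlowOf.exists_edist_map_neg_le (hφ : IsFlowOf φ V) (N : ℝ) :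
    ∃ C : ℝ≥0, ∀ (σ a : ℝ) (x y : Y) (η : ℝ≥0∞), |σ| ≤ N → edist a σ ≤ η →
      edist (φ a y) x ≤ η → edist y (φ (-σ) x) ≤ C * η := by
  obtain ⟨L, hL⟩ := hφ.exists_lipschitzWith N
  obtain ⟨K, hK⟩ := hφ.exists_edist_le_mul_enorm
  refine ⟨L * (K + 1), fun σ a x y η hσ haσ hay => ?_⟩
  have ha : edist (φ σ y) (φ a y) ≤ K * edist a σ := by
    rw [edist_comm, edist_eq_enorm_sub]
    simpa [← φ.map_add] using hK (φ σ y) (a - σ)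
  calc edist y (φ (-σ) x) = edist (φ (-σ) (φ σ y)) (φ (-σ) x) := by simp [← φ.map_add]
    _ ≤ L * edist (φ σ y) x := (hL _ (by rwa [abs_neg])).edist_le_mul _ _
    _ ≤ L * (K * η + η) := by grw [edist_triangle _ (φ a y) x, ha, haσ, hay]
    _ = _ := by push_cast; ring

variable [MeasurableSpace Y] [BorelSpace Y]

theorem IsFlowOf.exists_riemannianVolume_shiftEDist_le (hφ : IsFlowOf φ V) (hm : 1 ≤ m) :
    ∃ C : ℝ≥0, ∀ (x : Y) (η : ℝ≥0), η ≠ 0 →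
      riemannianVolume Y m {y | shiftEDist φ 1 y x ≤ η} ≤ C * (η : ℝ≥0∞) ^ (m - 1) := by
  obtain ⟨K, hK⟩ := hφ.exists_edist_map_neg_le 1
  obtain ⟨B, hB⟩ := exists_riemannianVolume_closedEBall_le (𝓡 m) Y
  have hfin := riemannianVolume_univ_ne_top (𝓡 m) Y
  rw [finrank_euclideanSpace_fin] at hB hfin
  lift riemannianVolume Y m univ to ℝ≥0 using hfin with v hv
  refine ⟨max v (3 * (B * K ^ m)), fun x η hη => ?_⟩
  rcases le_total 1 η with hη1 | hη1
  · calc riemannianVolume Y m {y | shiftEDist φ 1 y x ≤ η} ≤ v * 1 :=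
          (measure_mono (subset_univ _)).trans_eq (by rw [mul_one, hv])
      _ ≤ _ := by
          gcongr
          · exact le_max_left _ _
          · exact one_le_pow₀ (ENNReal.one_le_coe_iff.2 hη1)
  calc riemannianVolume Y m {y | shiftEDist φ 1 y x ≤ η}
      ≤ Metric.coveringNumber η (Icc (-1 : ℝ) 1) * (B * ((K * η : ℝ≥0) : ℝ≥0∞) ^ m) := by
        refine measure_le_coveringNumber_mul _
          (coveringNumber_ne_top_of_isCompact hη isCompact_Icc)
          (R := fun y σ => edist (φ σ y) x ≤ η) (fun y hy => ?_) fun σ hσ => ?_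
        · obtain ⟨σ, hσ, hσy⟩ := exists_edist_eq_shiftEDist (φ := φ) zero_le_one y x
          exact ⟨σ, abs_le.1 hσ, hσy.trans_le hy⟩
        · refine (measure_mono ?_).trans (hB (φ (-σ) x) _)
          rintro y ⟨a, haσ, hay⟩
          exact (hK σ a x y η (abs_le.2 hσ) haσ hay).trans_eq (ENNReal.coe_mul _ _).symm
    _ = Metric.coveringNumber η (Icc (-1 : ℝ) 1) * η * (B * K ^ m * η ^ (m - 1)) := by
        rw [ENNReal.coe_mul, mul_pow, ← mul_pow_sub_one (Nat.one_le_iff_ne_zero.1 hm) (η : ℝ≥0∞)]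
        ring
    _ ≤ 3 * (B * K ^ m * η ^ (m - 1)) := by
        gcongr
        refine (coveringNumber_Icc_mul_le (by norm_num) η).trans ?_
        grw [hη1]
        norm_num
    _ ≤ _ := by
        rw [← mul_assoc]
        gcongr
        exact_mod_cast le_max_right _ _

end Counting

section Recurrence

variable {m : ℕ} {Y : Type*} [EMetricSpace Y] [CompactSpace Y]
  [ChartedSpace (EuclideanSpace ℝ (Fin m)) Y]
  [RiemannianBundle fun y : Y => TangentSpace (𝓡 m) y] [IsManifold (𝓡 m) ∞ Y]
  [IsContinuousRiemannianBundle (EuclideanSpace ℝ (Fin m)) fun y : Y => TangentSpace (𝓡 m) y]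
  [IsRiemannianManifold (𝓡 m) Y]

variable (m Y) in
theorem exists_coveringNumber_mul_exp_le {l : ℝ} (hl : 0 ≤ l) {ρ : ℝ≥0} (hρ : ρ ≠ 0)
    (hρ1 : ρ ≤ 1) :
    ∃ C : ℝ≥0, ∀ T : ℝ, 0 ≤ T →
      (Metric.coveringNumber (ρ * (Real.exp (-(l * T))).toNNReal) (univ : Set Y) : ℝ≥0∞) ≤
        C * ENNReal.ofReal (Real.exp (m * l * T)) := by
  obtain ⟨B, hB⟩ := exists_coveringNumber_mul_pow_le (𝓡 m) Y
  rw [finrank_euclideanSpace_fin] at hB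
  refine ⟨B * (ρ⁻¹) ^ m, fun T hT => ?_⟩
  set r : ℝ≥0 := ρ * (Real.exp (-(l * T))).toNNReal with hr
  have hexp : (Real.exp (-(l * T))).toNNReal ≤ 1 := by
    rw [Real.toNNReal_le_one, Real.exp_le_one_iff]
    exact neg_nonpos.2 (by positivity)
  have hr0 : r ^ m ≠ 0 := by positivity
  have hpow : B / r ^ m = B * ρ⁻¹ ^ m * (Real.exp (m * l * T)).toNNReal := by
    rw [hr, mul_pow, div_eq_mul_inv, mul_inv, mul_assoc, inv_pow, ← inv_pow (Real.toNNReal _),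
      ← Real.toNNReal_inv, ← Real.exp_neg, neg_neg, ← Real.toNNReal_pow (Real.exp_pos _).le,
      ← Real.exp_nat_mul, mul_assoc (m : ℝ)]
  calc (Metric.coveringNumber r (univ : Set Y) : ℝ≥0∞) ≤ B / (r : ℝ≥0∞) ^ m := by
        rw [ENNReal.le_div_iff_mul_le (.inl (by exact_mod_cast hr0)) (.inl (by simp))]
        exact hB r (mul_le_one' hρ1 hexp)
    _ = ((B / r ^ m : ℝ≥0) : ℝ≥0∞) := by rw [ENNReal.coe_div hr0, ENNReal.coe_pow]
    _ = _ := by rw [hpow, ENNReal.coe_mul]; rfl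

variable [MeasurableSpace Y] [BorelSpace Y] {φ : Flow ℝ Y} {V : ∀ y : Y, TangentSpace (𝓡 m) y}
  {l t₀ : ℝ}

theorem IsQuasiAnosov.exists_riemannianVolume_thickening_le (hQ : IsQuasiAnosov φ V)
    (hφ : IsFlowOf φ V) (hm : 1 ≤ m) (ht₀ : 0 < t₀) :
    ∃ δ > 0, ∃ C : ℝ≥0, ∀ (ε : ℝ≥0) (P : Set (Y × ℝ)), ε ≠ 0 →
      (∀ p ∈ P, t₀ ≤ p.2 ∧ edist (φ p.2 p.1) p.1 ≤ ε) →
      (∀ p ∈ P, ∀ q ∈ P, |p.2 - q.2| ≤ δ ∧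
        ∀ s ∈ Icc 0 p.2, edist (φ s q.1) (φ s p.1) ≤ ENNReal.ofReal δ) →
      riemannianVolume Y m {y | ∃ p ∈ P, edist y p.1 ≤ 2 * ε} ≤ C * (ε : ℝ≥0∞) ^ (m - 1) := by
  obtain ⟨δ, hδ, K, hK⟩ := hQ.exists_shiftEDist_le hφ ht₀
  obtain ⟨L, hL⟩ := hφ.exists_lipschitzWith 1
  obtain ⟨B, hB⟩ := hφ.exists_riemannianVolume_shiftEDist_le hm
  set c : ℝ≥0 := 2 * L + K + 1
  refine ⟨δ, hδ, B * c ^ (m - 1), fun ε P hε hP hclose => ?_⟩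
  obtain rfl | ⟨p, hp⟩ := P.eq_empty_or_nonempty
  · simp
  calc riemannianVolume Y m {y | ∃ p ∈ P, edist y p.1 ≤ 2 * ε}
      ≤ riemannianVolume Y m {y | shiftEDist φ 1 y p.1 ≤ (c * ε : ℝ≥0)} := by
        refine measure_mono ?_
        rintro y ⟨q, hq, hyq⟩
        obtain ⟨σ, hσ, hσq⟩ := exists_edist_eq_shiftEDist (φ := φ) zero_le_one q.1 p.1
        have hqp : edist (φ σ q.1) p.1 ≤ K * ε := hσq.trans_le <|
          hK ε p.1 q.1 p.2 q.2 (hP p hp).1 (hclose p hp q hq).1 (hP p hp).2 (hP q hq).2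
            (hclose p hp q hq).2
        calc shiftEDist φ 1 y p.1 ≤ edist (φ σ y) p.1 := shiftEDist_le hσ _ _
          _ ≤ edist (φ σ y) (φ σ q.1) + edist (φ σ q.1) p.1 := edist_triangle _ _ _
          _ ≤ L * (2 * ε) + K * ε := by grw [(hL σ hσ).edist_le_mul y q.1, hyq, hqp]
          _ = ((2 * L + K : ℝ≥0) : ℝ≥0∞) * ε := by push_cast; ring
          _ ≤ (c * ε : ℝ≥0) := by
            rw [ENNReal.coe_mul]
            gcongr
            exact le_self_add
    _ ≤ B * ((c * ε : ℝ≥0) : ℝ≥0∞) ^ (m - 1) := hB _ _ (by positivity)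
    _ = _ := by push_cast; ring

theorem IsQuasiAnosov.exists_riemannianVolume_extendedRecurrenceSet_le_coveringNumber
    (hQ : IsQuasiAnosov φ V) (hφ : IsFlowOf φ V) (hm : 1 ≤ m) :
    ∃ δ : ℝ≥0, δ ≠ 0 ∧ ∃ C : ℝ≥0, ∀ (T : ℝ) (ε r : ℝ≥0), ε ≠ 0 → r ≠ 0 →
      (∀ x x' : Y, edist x' x ≤ 2 * r → ∀ s ∈ Icc 0 T, edist (φ s x') (φ s x) ≤ δ) →
      riemannianVolume Y m (extendedRecurrenceSet φ T ε) ≤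
        Metric.coveringNumber (δ / 2) (Icc 0 T) * (Metric.coveringNumber r (univ : Set Y) *
          (C * (ε : ℝ≥0∞) ^ (m - 1))) := by
  obtain ⟨t₀, ht₀, hperiod⟩ := hφ.exists_pos_le_of_half_shortestPeriod_le hQ.1
  obtain ⟨δ, hδ, C, hC⟩ := hQ.exists_riemannianVolume_thickening_le hφ hm ht₀
  lift δ to ℝ≥0 using hδ.le
  have hδ0 : δ ≠ 0 := (NNReal.coe_pos.1 hδ).ne'
  refine ⟨δ, hδ0, C, fun T ε r hε hr hclose => ?_⟩
  refine measure_le_coveringNumber_mul_coveringNumber_mul _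
    (coveringNumber_ne_top_of_isCompact (div_ne_zero hδ0 two_ne_zero) isCompact_Icc)
    (coveringNumber_ne_top_of_isCompact hr isCompact_univ)
    (R := fun y t x => (x, t) ∈ liftedRecurrenceSet φ T ε ∧ edist y x ≤ 2 * ε)
    (fun y hy => ?_) fun t _ x _ => ?_
  · have hlt : Metric.infEDist y (recurrenceSet φ T ε) < 2 * ε := hy.trans_lt (by
      rw [ENNReal.ofReal_coe_nnreal, two_mul]
      exact ENNReal.lt_add_right ENNReal.coe_ne_top (ENNReal.coe_ne_zero.2 hε))
    obtain ⟨x, ⟨t, hxt⟩, hyx⟩ := Metric.infEDist_lt_iff.1 hlt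
    exact ⟨t, ⟨hxt.1, hxt.2.2.1⟩, x, mem_univ x, hxt, hyx.le⟩
  · refine (measure_mono ?_).trans (hC ε {p ∈ liftedRecurrenceSet φ T ε |
      edist p.1 x ≤ r ∧ edist p.2 t ≤ (δ / 2 : ℝ≥0)} hε
      (fun p hp => ⟨hperiod _ hp.1.2.1, by simpa using hp.1.2.2.2⟩)
      fun p hp q hq => ⟨?_, fun s hs => ?_⟩)
    · rintro y ⟨x', hx', t', ht', hlift, hy⟩
      exact ⟨(x', t'), ⟨hlift, hx', ht'⟩, hy⟩
    · have hpq := (edist_triangle_right p.2 q.2 t).trans (add_le_add hp.2.2 hq.2.2)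
      rw [← ENNReal.coe_add, add_halves, edist_nndist, ENNReal.coe_le_coe] at hpq
      exact_mod_cast hpq
    · rw [ENNReal.ofReal_coe_nnreal]
      refine hclose p.1 q.1 ?_ s ⟨hs.1, hs.2.trans hp.1.2.2.1⟩
      exact (edist_triangle_right q.1 p.1 x).trans
        ((add_le_add hq.2.1 hp.2.1).trans_eq (two_mul _).symm)

theorem IsQuasiAnosov.exists_riemannianVolume_extendedRecurrenceSet_le (hQ : IsQuasiAnosov φ V)
    (hφ : IsFlowOf φ V) (hm : 1 ≤ m) (hl0 : 0 ≤ l)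
    (hl : maximalExpansionRate m φ < (l : EReal)) :
    ∃ C : ℝ≥0, ∀ (T : ℝ) (ε : ℝ≥0), 0 ≤ T → ε ≠ 0 →
      riemannianVolume Y m (extendedRecurrenceSet φ T ε) ≤
        C * ENNReal.ofReal (T + 1) * ENNReal.ofReal (Real.exp (m * l * T)) *
          (ε : ℝ≥0∞) ^ (m - 1) := by
  obtain ⟨δ, hδ, B, hB⟩ :=
    hQ.exists_riemannianVolume_extendedRecurrenceSet_le_coveringNumber hφ hm
  obtain ⟨ρ, hρ, hρ1, hclose⟩ := hφ.exists_forall_edist_map_le hl0 hl hδ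
  obtain ⟨D, hD⟩ := exists_coveringNumber_mul_exp_le m Y hl0 hρ hρ1
  obtain ⟨C, hC⟩ := exists_coveringNumber_Icc_zero_le (div_ne_zero hδ two_ne_zero)
  refine ⟨C * D * B, fun T ε hT hε => ?_⟩
  calc riemannianVolume Y m (extendedRecurrenceSet φ T ε)
      ≤ _ := hB T ε (ρ * (Real.exp (-(l * T))).toNNReal) hε
        (mul_ne_zero hρ (Real.toNNReal_pos.2 (Real.exp_pos _)).ne') (hclose T)
    _ ≤ C * ENNReal.ofReal (T + 1) * (D * ENNReal.ofReal (Real.exp (m * l * T)) *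
        (B * (ε : ℝ≥0∞) ^ (m - 1))) := by
        gcongr
        · exact hC T hT
        · exact hD T hT
    _ = _ := by push_cast; ring

end Recurrence

section RiemannianBundle

variable {EB HB B F : Type*} [NormedAddCommGroup EB] [NormedSpace ℝ EB] [TopologicalSpace HB]
  {IB : ModelWithCorners ℝ EB HB} {n : ℕ∞ω} [TopologicalSpace B] [ChartedSpace HB B]
  [NormedAddCommGroup F] [NormedSpace ℝ F] {E : B → Type*} [TopologicalSpace (TotalSpace F E)]
  [∀ x, NormedAddCommGroup (E x)] [∀ x, InnerProductSpace ℝ (E x)] [FiberBundle F E]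
  [VectorBundle ℝ F E]

theorem isContinuousRiemannianBundle_of_isContMDiffRiemannianBundle
    (h : IsContMDiffRiemannianBundle IB n F E) : IsContinuousRiemannianBundle F E := by
  obtain ⟨g, hg, hinner⟩ := h.exists_contMDiff
  exact ⟨g, hg.continuous, hinner⟩

end RiemannianBundle

theorem exists_add_one_sq_le_exp {a : ℝ} (ha : 0 < a) :
    ∃ C : ℝ≥0, ∀ T, 0 ≤ T → (T + 1) ^ 2 ≤ C * Real.exp (a * T) := by
  obtain ⟨b, hb, hb1, hba⟩ : ∃ b > 0, b ≤ 1 ∧ 2 * b ≤ a :=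
    ⟨min 1 (a / 2), by positivity, min_le_left _ _, by linarith [min_le_right 1 (a / 2)]⟩
  refine ⟨.mk (b ^ 2)⁻¹ (by positivity), fun T hT => ?_⟩
  rw [NNReal.coe_mk, ← div_eq_inv_mul, le_div_iff₀ (by positivity)]
  calc (T + 1) ^ 2 * b ^ 2 = (b * T + b) ^ 2 := by ring
    _ ≤ Real.exp (b * T) ^ 2 := by
        gcongr
        linarith [Real.add_one_le_exp (b * T)]
    _ = Real.exp (2 * b * T) := by rw [← Real.exp_nat_mul, Nat.cast_ofNat, mul_assoc]
    _ ≤ Real.exp (a * T) := by gcongr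

theorem exists_ofReal_add_one_sq_mul_exp_le {a b : ℝ} (hab : a < b) :
    ∃ C : ℝ≥0, ∀ T : ℝ, 0 ≤ T →
      ENNReal.ofReal (T + 1) ^ 2 * ENNReal.ofReal (Real.exp (a * T)) ≤
        C * ENNReal.ofReal (Real.exp (b * T)) := by
  obtain ⟨C, hC⟩ := exists_add_one_sq_le_exp (sub_pos.2 hab)
  refine ⟨C, fun T hT => ?_⟩
  rw [← ENNReal.ofReal_pow (by positivity), ← ENNReal.ofReal_mul (by positivity),
    ← ENNReal.ofReal_coe_nnreal, ← ENNReal.ofReal_mul C.coe_nonneg]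
  refine ENNReal.ofReal_le_ofReal ?_
  calc (T + 1) ^ 2 * Real.exp (a * T) ≤ C * Real.exp ((b - a) * T) * Real.exp (a * T) := by
        gcongr
        exact hC T hT
    _ = C * Real.exp (b * T) := by rw [mul_assoc, ← Real.exp_add, ← add_mul, sub_add_cancel]

section RecurrenceSet

variable {Y : Type*} [EMetricSpace Y] (φ : Flow ℝ Y) (T ε : ℝ)

theorem shortestPeriod_of_isEmpty {Z : Type*} [TopologicalSpace Z] [IsEmpty Z] (ψ : Flow ℝ Z) :
    shortestPeriod ψ = ⊤ := by
  simp [shortestPeriod]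

theorem recurrenceSet_subset_extendedRecurrenceSet :
    recurrenceSet φ T ε ⊆ extendedRecurrenceSet φ T ε := fun _ hy =>
  (Metric.infEDist_zero_of_mem hy).trans_le zero_le

theorem isClosed_liftedRecurrenceSet : IsClosed (liftedRecurrenceSet φ T ε) := by
  have hφ : Continuous fun p : Y × ℝ => φ p.2 p.1 := φ.continuous continuous_snd continuous_fst
  exact (isClosed_le continuous_const continuous_snd).inter <|
    (isClosed_le continuous_const (ENNReal.continuous_ofReal.comp continuous_snd)).inter <|
    (isClosed_le continuous_snd continuous_const).inter <|
    isClosed_le (hφ.edist continuous_fst) continuous_const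

variable {φ T ε} in
theorem prod_liftedRecurrenceSet_le [MeasurableSpace Y] [BorelSpace Y] (μ : Measure Y) {c : ℝ≥0∞}
    (hc : ∀ y, volume (Prod.mk y ⁻¹' liftedRecurrenceSet φ T ε) ≤ c) :
    μ.prod volume (liftedRecurrenceSet φ T ε) ≤ c * μ (recurrenceSet φ T ε) := by
  calc μ.prod volume (liftedRecurrenceSet φ T ε)
      = ∫⁻ y, volume (Prod.mk y ⁻¹' liftedRecurrenceSet φ T ε) ∂μ :=
        Measure.prod_apply (isClosed_liftedRecurrenceSet φ T ε).measurableSet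
    _ ≤ ∫⁻ y, (recurrenceSet φ T ε).indicator (fun _ => c) y ∂μ := by
        refine lintegral_mono fun y => ?_
        by_cases hy : y ∈ recurrenceSet φ T ε
        · exact (hc y).trans_eq (indicator_of_mem hy fun _ => c).symm
        · have hslice : Prod.mk y ⁻¹' liftedRecurrenceSet φ T ε = ∅ :=
            eq_empty_of_forall_notMem fun t ht => hy ⟨t, ht⟩
          simp only [hslice, measure_empty, zero_le]
    _ ≤ c * μ (recurrenceSet φ T ε) := lintegral_indicator_const_le _ _

end RecurrenceSet

section QuasiAnosov

variable {m : ℕ} {Y : Type*} [EMetricSpace Y] [ChartedSpace (EuclideanSpace ℝ (Fin m)) Y]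
  [RiemannianBundle fun y : Y => TangentSpace (𝓡 m) y] {φ : Flow ℝ Y}
  {V : ∀ y : Y, TangentSpace (𝓡 m) y}

theorem IsQuasiAnosov.one_le_dim [Nonempty Y] (hQ : IsQuasiAnosov φ V) : 1 ≤ m := by
  obtain ⟨y⟩ := ‹Nonempty Y›
  rw [Nat.one_le_iff_ne_zero]
  rintro rfl
  exact hQ.1 y (Subsingleton.elim (α := EuclideanSpace ℝ (Fin 0)) _ _)

variable [CompactSpace Y] [IsManifold (𝓡 m) ∞ Y]
  [IsContinuousRiemannianBundle (EuclideanSpace ℝ (Fin m)) fun y : Y => TangentSpace (𝓡 m) y]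
  [IsRiemannianManifold (𝓡 m) Y] [MeasurableSpace Y] [BorelSpace Y]

theorem IsQuasiAnosov.exists_prod_liftedRecurrenceSet_le (hQ : IsQuasiAnosov φ V)
    (hφ : IsFlowOf φ V) (hm : 1 ≤ m) {l : ℝ} (hl0 : 0 ≤ l)
    (hl : maximalExpansionRate m φ < (l : EReal)) :
    ∃ C : ℝ≥0, ∀ (T : ℝ) (ε : ℝ≥0), 0 ≤ T → ε ≠ 0 →
      (riemannianVolume Y m).prod volume (liftedRecurrenceSet φ T ε) ≤
        C * ENNReal.ofReal (T + 1) ^ 2 * ENNReal.ofReal (Real.exp (m * l * T)) *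
          (ε : ℝ≥0∞) ^ m := by
  obtain ⟨A, hA⟩ := hQ.exists_riemannianVolume_extendedRecurrenceSet_le hφ hm hl0 hl
  obtain ⟨B, hB⟩ := hφ.exists_volume_slice_le hQ.1
  refine ⟨A * B, fun T ε hT hε => ?_⟩
  calc (riemannianVolume Y m).prod volume (liftedRecurrenceSet φ T ε)
      ≤ B * ENNReal.ofReal (T + 1) * ε * riemannianVolume Y m (recurrenceSet φ T ε) :=
        prod_liftedRecurrenceSet_le _ fun y => hB T ε y hT
    _ ≤ B * ENNReal.ofReal (T + 1) * ε * (A * ENNReal.ofReal (T + 1) *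
          ENNReal.ofReal (Real.exp (m * l * T)) * (ε : ℝ≥0∞) ^ (m - 1)) := by
        grw [recurrenceSet_subset_extendedRecurrenceSet, hA T ε hT hε]
    _ = _ := by
        rw [← mul_pow_sub_one (Nat.one_le_iff_ne_zero.1 hm) (ε : ℝ≥0∞)]
        push_cast
        ring

theorem IsQuasiAnosov.exists_volume_recurrenceSets_le [Nonempty Y] (hQ : IsQuasiAnosov φ V)
    (hφ : IsFlowOf φ V) {lam : ℝ} (hlam : maximalExpansionRate m φ < (lam : EReal)) :
    ∃ C : ℝ≥0, ∀ (T : ℝ) (ε : ℝ≥0), 0 ≤ T → ε ≠ 0 →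
      (riemannianVolume Y m).prod volume (liftedRecurrenceSet φ T ε) ≤
        C * (ε : ℝ≥0∞) ^ m * ENNReal.ofReal (Real.exp (m * lam * T)) ∧
      riemannianVolume Y m (extendedRecurrenceSet φ T ε) ≤
        C * (ε : ℝ≥0∞) ^ (m - 1) * ENNReal.ofReal (Real.exp (m * lam * T)) := by
  have hm := hQ.one_le_dim
  obtain ⟨l, hl, hll⟩ := EReal.lt_iff_exists_real_btwn.1 hlam
  have hl0 := hφ.expansionRate_nonneg hQ.1 hl
  obtain ⟨A, hA⟩ := hQ.exists_prod_liftedRecurrenceSet_le hφ hm hl0 hl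
  obtain ⟨B, hB⟩ := hQ.exists_riemannianVolume_extendedRecurrenceSet_le hφ hm hl0 hl
  obtain ⟨D, hD⟩ := exists_ofReal_add_one_sq_mul_exp_le
    (mul_lt_mul_of_pos_left (EReal.coe_lt_coe_iff.1 hll) (Nat.cast_pos.2 hm : (0 : ℝ) < m))
  have absorb : ∀ {F : ℝ≥0} {T : ℝ} {x v : ℝ≥0∞}, 0 ≤ T → F ≤ max A B →
      v ≤ F * ENNReal.ofReal (T + 1) ^ 2 * ENNReal.ofReal (Real.exp (m * l * T)) * x →
      v ≤ ((max A B * D : ℝ≥0) : ℝ≥0∞) * x * ENNReal.ofReal (Real.exp (m * lam * T)) := by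
    intro F T x v hT hF hv
    calc v ≤ F * x * (ENNReal.ofReal (T + 1) ^ 2 * ENNReal.ofReal (Real.exp (m * l * T))) :=
          hv.trans_eq (by ring)
      _ ≤ (max A B : ℝ≥0) * x * (D * ENNReal.ofReal (Real.exp (m * lam * T))) := by
          grw [hD T hT, hF]
      _ = _ := by rw [ENNReal.coe_mul]; ring
  refine ⟨max A B * D, fun T ε hT hε => ⟨absorb hT (le_max_left _ _) (hA T ε hT hε),
    absorb hT (le_max_right _ _) ((hB T ε hT hε).trans ?_)⟩⟩
  gcongr
  exact le_self_pow (by simpa using hT) two_ne_zero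

end QuasiAnosov

end AnosovRecurrence

end

open AnosovRecurrence in
theorem mainTheorem8_general {m : ℕ} {Y : Type*} [EMetricSpace Y] [CompactSpace Y]
    [ChartedSpace (EuclideanSpace ℝ (Fin m)) Y] [IsManifold (𝓡 m) ∞ Y]
    [RiemannianBundle (fun y : Y => TangentSpace (𝓡 m) y)]
    [IsContinuousRiemannianBundle (EuclideanSpace ℝ (Fin m))
      (fun y : Y => TangentSpace (𝓡 m) y)]
    [IsRiemannianManifold (𝓡 m) Y]
    [MeasurableSpace Y] [BorelSpace Y]
    (V : ∀ y : Y, TangentSpace (𝓡 m) y)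
    (φ : Flow ℝ Y) (hφ : IsFlowOf φ V) (hQ : IsQuasiAnosov φ V)
    (lam : ℝ) (hlam : maximalExpansionRate m φ < (lam : EReal)) :
    ∃ C : ℝ, 0 < C ∧ ∀ ε : ℝ, 0 < ε → ∀ T : ℝ,
      shortestPeriod φ / 2 < ENNReal.ofReal T →
      ((riemannianVolume Y m).prod volume) (liftedRecurrenceSet φ T ε)
        ≤ ENNReal.ofReal (C * ε ^ m * Real.exp (m * lam * T)) ∧
      riemannianVolume Y m (recurrenceSet φ T ε)
        ≤ ENNReal.ofReal (C * ε ^ (m - 1) * Real.exp (m * lam * T)) ∧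
      riemannianVolume Y m (extendedRecurrenceSet φ T ε)
        ≤ ENNReal.ofReal (C * ε ^ (m - 1) * Real.exp (m * lam * T)) := by
  rcases isEmpty_or_nonempty Y with hY | hY
  · refine ⟨1, one_pos, fun ε _ T hT => absurd hT ?_⟩
    simp [shortestPeriod_of_isEmpty, ENNReal.top_div_of_ne_top]
  obtain ⟨C, hC⟩ := hQ.exists_volume_recurrenceSets_le hφ hlam
  obtain ⟨t₀, ht₀, hperiod⟩ := hφ.exists_pos_le_of_half_shortestPeriod_le hQ.1
  have hofReal : ∀ (k : ℕ) (ε : ℝ≥0) (x : ℝ),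
      (C : ℝ≥0∞) * (ε : ℝ≥0∞) ^ k * ENNReal.ofReal (Real.exp x) ≤
        ENNReal.ofReal ((C + 1 : ℝ≥0) * ε ^ k * Real.exp x) := fun k ε x => by
    rw [← NNReal.coe_pow, ← NNReal.coe_mul, ENNReal.ofReal_mul NNReal.zero_le_coe,
      ENNReal.ofReal_coe_nnreal, ENNReal.coe_mul, ENNReal.coe_pow]
    gcongr
    exact le_self_add
  refine ⟨(C + 1 : ℝ≥0), by positivity, fun ε hε T hT => ?_⟩
  lift ε to ℝ≥0 using hε.le
  obtain ⟨hlift, hext⟩ := hC T ε (ht₀.le.trans (hperiod T hT.le)) (NNReal.coe_pos.1 hε).ne'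
  have hext' := hext.trans (hofReal (m - 1) ε _)
  exact ⟨hlift.trans (hofReal m ε _),
    (measure_mono (recurrenceSet_subset_extendedRecurrenceSet φ T ε)).trans hext', hext'⟩

theorem mainTheorem8 {m : ℕ} {Y : Type*} [EMetricSpace Y] [CompactSpace Y]
    [ChartedSpace (EuclideanSpace ℝ (Fin m)) Y] [IsManifold (𝓡 m) ∞ Y]
    [RiemannianBundle (fun y : Y => TangentSpace (𝓡 m) y)]
    [IsContMDiffRiemannianBundle (𝓡 m) ∞ (EuclideanSpace ℝ (Fin m))
      (fun y : Y => TangentSpace (𝓡 m) y)]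
    [IsRiemannianManifold (𝓡 m) Y]
    [MeasurableSpace Y] [BorelSpace Y]
    (V : ∀ y : Y, TangentSpace (𝓡 m) y)
    (hV : ContMDiff (𝓡 m) (𝓡 m).tangent ∞ (AnosovRecurrence.toSection V))
    (φ : Flow ℝ Y) (hφ : AnosovRecurrence.IsFlowOf φ V)
    (hA : AnosovRecurrence.IsAnosov φ V)
    (lam : ℝ) (hlam : AnosovRecurrence.maximalExpansionRate m φ < (lam : EReal)) :
    ∃ C : ℝ, 0 < C ∧ ∀ ε : ℝ, 0 < ε → ∀ T : ℝ,
      AnosovRecurrence.shortestPeriod φ / 2 < ENNReal.ofReal T →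
      ((AnosovRecurrence.riemannianVolume Y m).prod volume)
          (AnosovRecurrence.liftedRecurrenceSet φ T ε)
        ≤ ENNReal.ofReal (C * ε ^ m * Real.exp (m * lam * T)) ∧
      AnosovRecurrence.riemannianVolume Y m (AnosovRecurrence.recurrenceSet φ T ε)
        ≤ ENNReal.ofReal (C * ε ^ (m - 1) * Real.exp (m * lam * T)) ∧
      AnosovRecurrence.riemannianVolume Y m (AnosovRecurrence.extendedRecurrenceSet φ T ε)
        ≤ ENNReal.ofReal (C * ε ^ (m - 1) * Real.exp (m * lam * T)) :=
  haveI : IsContinuousRiemannianBundle (EuclideanSpace ℝ (Fin m))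
      (fun y : Y => TangentSpace (𝓡 m) y) :=
    AnosovRecurrence.isContinuousRiemannianBundle_of_isContMDiffRiemannianBundle
      (IB := 𝓡 m) (n := ∞) inferInstance
  mainTheorem8_general V φ hφ (hA.isQuasiAnosov hφ) lam hlam
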